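/- **Extended stochastic sewing lemma.** Let $(\Omega,\mathcal F,\mathbb P)$ be a probability space with a filtration $(\mathcal F_t)_{t\in[0,T]}$, $T\ge 0$, let $m\in[2,\infty)$, and let $(A_{s,t})_{0\le s\le t\le T}$ be $\mathbb R^d$-valued random variables such that $A_{s,s}=0$, $A_{s,t}$ is $\mathcal F_t$-measurable and $A_{s,t}\in L_m(\mathbb P)$. Put $\delta A_{s,u,t}:=A_{s,t}-A_{s,u}-A_{u,t}$ for $s<u<t$. Let $\Gamma_1,\Gamma_2,M,\alpha,\beta_1,\beta_2\in[0,\infty)$ be such that for all $0\le t_0<t_1<t_2<t_3\le T$ $$\|\mathbb E[\delta A_{t_1,t_2,t_3}\mid\mathcal F_{t_0}]\|_{L_m}\le\Gamma_1(t_1-t_0)^{-\alpha}(t_3-t_1)^{\beta_1}\quad\text{if } M(t_3-t_1)\le t_1-t_0,$$ for all $0\le t_0<t_1<t_2\le T$ $$\|\delta A_{t_0,t_1,t_2}\|_{L_m}\le\Gamma_2(t_2-t_0)^{\beta_2},$$ and $\beta_1>1$, $\beta_2>\tfrac12$, $\beta_1-\alpha>\tfrac12$. Then there is a process $(\mathcal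 A_t)_{t\in[0,T]}$, unique up to modifications, with values in $\mathbb R^d$ and the following properties: * $\mathcal A_0=0$ almost surely, $\mathcal A_t$ is $\mathcal F_t$-measurable, and $\mathcal A_t\in L_m(\mathbb P)$ for all $t\in[0,T]$; * there are constants $C_1,C_2,C_3\ge 0$ such that for all $0\le t_0<t_1<t_2\le T$ with $M(t_2-t_1)\le t_1-t_0$ $$\|\mathbb E[\mathcal A_{t_2}-\mathcal A_{t_1}-A_{t_1,t_2}\mid\mathcal F_{t_0}]\|_{L_m}\le C_1(t_1-t_0)^{-\alpha}(t_2-t_1)^{\beta_1},$$ and for all $0\le t_1<t_2\le T$ $$\|\mathcal A_{t_2}-\mathcal A_{t_1}-A_{t_1,t_2}\|_{L_m}\le C_2(t_2-t_1)^{\beta_1-\alpha}+C_3(t_2-t_1)^{\beta_2}.$$ Moreover, these constants can be chosen such that $$C_1\le K_1\Gamma_1,\qquad C_2\le K_2\,\kappa_{m,d}\,\Gamma_1,\qquad C_3\le K_3\,\kappa_{m,d}\,\Gamma_2,$$ where $K_1$ depends only on $\beta_1$, where $K_2,K_3$ depend only on $\alpha,\beta_1,\beta_2,M$, and where $\kappa_{m,d}$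 is the best constant of the discrete Burkholder–Davis–Gundy inequality, i.e. the smallest $\kappa\ge 0$ such that $$\Big\|\sum_n X_n\Big\|_{L_m}\le\kappa\,\Big\|\sum_n|X_n|^2\Big\|_{L_{m/2}}^{1/2}$$ for all finite $\mathbb R^d$-valued sequences $(X_n)_{n=1}^N$ in $L_m$ that are adapted to some filtration $(\mathcal G_n)$ on some probability space and satisfy $\mathbb E[X_n\mid\mathcal G_{n-1}]=0$ for $n\ge 2$. Finally, for every $\tau\in[0,T]$, the sums $A^\pi_\tau:=\sum_{[s,t]\in\pi}A_{s,t}$ over partitions $\pi$ of $[0,\tau]$ converge to $\mathcal A_\tau$ in $L_m(\mathbb P)$ as the mesh $|\pi|=\max_{[s,t]\in\pi}|t-s|$ tends to $0$. -/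

import Mathlib

open MeasureTheory ProbabilityTheory Filter Topology
open scoped ENNReal

universe u

noncomputable section

/-- `δA_{s,u,t} = A_{s,t} - A_{s,u} - A_{u,t}`, as a random variable. -/
def sewDelta {Ω ι E : Type*} [AddCommGroup E] (A : ι → ι → Ω → E) (s u t : ι) : Ω → E :=
  fun ω => A s t ω - A s u ω - A u t ω

/-- `c` is an admissible constant in the discrete Burkholder-Davis-Gundy inequality for
`ℝ^d`-valued martingale differences with exponent `m`: if `X n` is `𝓖 n`-measurable for all `n`
and `E[X (n+1) | 𝓖 n] = 0` for all `n` (nothing is required of the mean of the first term `X 0`),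
then `‖∑ X_n‖_{L_m} ≤ c ‖∑ |X_n|²‖_{L_{m/2}}^{1/2}` for all finite sums. (When some `X n` is not in
`L_m` the right-hand side is infinite, so only `L_m`-sequences matter.) -/
def IsBDGConstant (m : ℝ) (d : ℕ) (c : ℝ) : Prop :=
  ∀ (Ω : Type u) (mΩ : MeasurableSpace Ω) (P : Measure Ω) (_ : IsProbabilityMeasure P)
    (𝓖 : Filtration ℕ mΩ) (X : ℕ → Ω → EuclideanSpace ℝ (Fin d)),
    (∀ n, StronglyMeasurable[𝓖 n] (X n)) →
    (∀ n, MemLp (X n) (ENNReal.ofReal m) P) →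
    (∀ n, P[X (n + 1) | 𝓖 n] =ᵐ[P] 0) →
    ∀ N : ℕ,
      eLpNorm (fun ω => ∑ n ∈ Finset.range N, X n ω) (ENNReal.ofReal m) P ≤
        ENNReal.ofReal c *
          (eLpNorm (fun ω => ∑ n ∈ Finset.range N, ‖X n ω‖ ^ 2) (ENNReal.ofReal (m / 2)) P)
            ^ (1 / 2 : ℝ)

/-- The best constant `κ_{m,d}` of the discrete Burkholder-Davis-Gundy inequality. -/
def bdgConst (m : ℝ) (d : ℕ) : ℝ :=
  sInf {c : ℝ | 0 ≤ c ∧ IsBDGConstant.{u} m d c}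

/-- A partition `0 = t_0 < t_1 < ⋯ < t_n = τ` of `[0, τ]`, where `τ ∈ [0, T]`. The values
`pt i` with `i > n` are irrelevant. For `τ = 0` the only possibility is `n = 0`. -/
structure PartitionUpTo {T : ℝ} (τ : Set.Icc (0 : ℝ) T) where
  /-- the number of subintervals -/
  n : ℕ
  /-- the partition points -/
  pt : ℕ → Set.Icc (0 : ℝ) T
  pt_lt : ∀ i < n, pt i < pt (i + 1)
  pt_zero : (pt 0 : ℝ) = 0
  pt_last : pt n = τ

/-- The mesh `|π| = max_{[s,t] ∈ π} |t - s|` (equal to `0` if there is no subinterval). -/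
def PartitionUpTo.mesh {T : ℝ} {τ : Set.Icc (0 : ℝ) T} (π : PartitionUpTo τ) : ℝ :=
  ⨆ i : Fin π.n, |(π.pt (i + 1) : ℝ) - π.pt i|

/-- The Riemann sum `A^π_τ = ∑_{[s,t] ∈ π} A_{s,t}`. -/
def PartitionUpTo.riemannSum {T : ℝ} {τ : Set.Icc (0 : ℝ) T} {Ω E : Type*} [AddCommGroup E]
    (π : PartitionUpTo τ) (A : Set.Icc (0 : ℝ) T → Set.Icc (0 : ℝ) T → Ω → E) : Ω → E :=
  fun ω => ∑ i ∈ Finset.range π.n, A (π.pt i) (π.pt (i + 1)) ω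

/-- The conditional and the unconditional bound on `𝒜_{t₂} - 𝒜_{t₁} - A_{t₁,t₂}`, with constants
`C₁` and `C₂, C₃`. The condition `t₂ - t₁ ≤ M⁻¹ (t₁ - t₀)` is written
`M (t₂ - t₁) ≤ t₁ - t₀`, which is void for `M = 0`. -/
def SewingBounds {Ω : Type*} {mΩ : MeasurableSpace Ω} (P : Measure Ω) {d : ℕ} {T : ℝ}
    (𝓕 : Filtration (Set.Icc (0 : ℝ) T) mΩ)
    (A : Set.Icc (0 : ℝ) T → Set.Icc (0 : ℝ) T → Ω → EuclideanSpace ℝ (Fin d))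
    (m M α β₁ β₂ : ℝ) (𝒜 : Set.Icc (0 : ℝ) T → Ω → EuclideanSpace ℝ (Fin d))
    (C₁ C₂ C₃ : ℝ) : Prop :=
  (∀ t₀ t₁ t₂ : Set.Icc (0 : ℝ) T, t₀ < t₁ → t₁ < t₂ →
    M * ((t₂ : ℝ) - t₁) ≤ (t₁ : ℝ) - t₀ →
    eLpNorm (P[fun ω => 𝒜 t₂ ω - 𝒜 t₁ ω - A t₁ t₂ ω | 𝓕 t₀]) (ENNReal.ofReal m) P ≤
      ENNReal.ofReal (C₁ * ((t₁ : ℝ) - t₀) ^ (-α) * ((t₂ : ℝ) - t₁) ^ β₁)) ∧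
  (∀ t₁ t₂ : Set.Icc (0 : ℝ) T, t₁ < t₂ →
    eLpNorm (fun ω => 𝒜 t₂ ω - 𝒜 t₁ ω - A t₁ t₂ ω) (ENNReal.ofReal m) P ≤
      ENNReal.ofReal (C₂ * ((t₂ : ℝ) - t₁) ^ (β₁ - α) + C₃ * ((t₂ : ℝ) - t₁) ^ β₂))

/-- The properties that characterize the process `𝒜`: it starts at `0`, is adapted and in `L_m`,
and satisfies the two bounds for some non-negative constants. -/
structure IsSewing {Ω : Type*} {mΩ : MeasurableSpace Ω} (P : Measure Ω) {d : ℕ} {T : ℝ}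
    (𝓕 : Filtration (Set.Icc (0 : ℝ) T) mΩ)
    (A : Set.Icc (0 : ℝ) T → Set.Icc (0 : ℝ) T → Ω → EuclideanSpace ℝ (Fin d))
    (m M α β₁ β₂ : ℝ) (𝒜 : Set.Icc (0 : ℝ) T → Ω → EuclideanSpace ℝ (Fin d)) : Prop where
  initial : ∀ t : Set.Icc (0 : ℝ) T, (t : ℝ) = 0 → 𝒜 t =ᵐ[P] 0
  adapted : ∀ t, StronglyMeasurable[𝓕 t] (𝒜 t)
  memLp : ∀ t, MemLp (𝒜 t) (ENNReal.ofReal m) P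
  bounds : ∃ C₁ C₂ C₃ : ℝ, 0 ≤ C₁ ∧ 0 ≤ C₂ ∧ 0 ≤ C₃ ∧
    SewingBounds P 𝓕 A m M α β₁ β₂ 𝒜 C₁ C₂ C₃

end

set_option linter.unusedSectionVars false

/-! The process is the limit of the sums of `A` along dyadic grids, and all its `L_m` estimates rest
on one bound for sums of random variables. Refining a grid of step `h` changes the sum by the `δA`
of the cells, of which there are about `1 / h`. The triangle inequality would require `β₂ > 1`. For
martingale differences the Burkholder-Davis-Gundy (BDG) inequality requires only `β₂ > 1/2`, but the
`δA` are not centered: their conditional expectations are controlled only at some distance from the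
past, with a factor that blows up like distance to the power `-α`.

The bound is `IsBDGConstant.eLpNorm_sum_two_pow_le`. Take `2 ^ n` variables of size `b` whose
conditional expectation over a lag `k ≥ L` has size `g k ^ (-α)`. Subtract from each its conditional
expectation at lag `L`. The differences split into `L + 1` martingale difference sequences and cost
a multiple of `κ b 2 ^ (n/2)`. The subtracted terms have size at most `g`; added in pairs they form
half as many variables on a time scale twice as long, with size `2 g` and decay constant `2 ^ (1 -
α) g`, and the argument repeats. The recursion closes with a multiple of `κ (b 2 ^ (n/2) + g 2 ^ (n
θ))` whenever `θ ≥ 1/2` and `θ > 1 - α`. For cells of length `h`, `b = Γ₂ h ^ β₂` and `g = Γ₁ h ^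
(β₁ - α)`. Summing over all dyadic scales requires `β₂ > 1/2` and `θ < β₁ - α`; such a `θ` exists
because `β₁ - α > 1/2` and `β₁ > 1`.

The conditional bound on `𝒜` uses only the triangle inequality, because `β₁ > 1`; this is why its
constant depends on `β₁` alone.

For convergence along arbitrary partitions, `𝒜 τ - A^π_τ` is a sum of remainders `𝒜 t - 𝒜 s - A s
t`, which obey bounds of the same type as `δA`. Partition intervals are sorted by dyadic length.
Those of comparable length occupy different time windows, so the same bound applies, and a small
mesh leaves only the tail of a convergent series. Uniqueness follows, since any two candidates are
limits of the same sums.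

The BDG inequality itself is proved from Doob's maximal inequality and a second-order expansion of
`‖x‖ ^ m`. Without it the infimum defining `bdgConst` could be that of an empty set, hence `0`. -/

/-! ### Elementary inequalities for powers and norms -/

theorem mul_rpow_sub_one_le_young {a b p : ℝ} (ha : 0 ≤ a) (hb : 0 ≤ b) (hp : 1 ≤ p) :
    p * (a * b ^ (p - 1)) ≤ a ^ p + (p - 1) * b ^ p := by
  have hp0 : 0 < p := by linarith
  have h := Real.geom_mean_le_arith_mean2_weighted (w₁ := 1 / p) (w₂ := (p - 1) / p)
    (p₁ := a ^ p) (p₂ := b ^ p) (by positivity) (div_nonneg (by linarith) hp0.le)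
    (by positivity) (by positivity) (by field_simp; ring)
  rw [← Real.rpow_mul ha, ← Real.rpow_mul hb, mul_one_div_cancel hp0.ne', Real.rpow_one,
    mul_div_cancel₀ _ hp0.ne'] at h
  calc p * (a * b ^ (p - 1)) ≤ p * (1 / p * a ^ p + (p - 1) / p * b ^ p) := by gcongr
    _ = _ := by field_simp

theorem rpow_add_one_sub_le {u v s : ℝ} (hu : 0 ≤ u) (hv : 0 ≤ v) (hs : 0 ≤ s) :
    v ^ (s + 1) - u ^ (s + 1) ≤ (s + 1) * v ^ s * (v - u) := by
  have h := mul_rpow_sub_one_le_young hu hv (p := s + 1) (by linarith)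
  have hvs : v ^ (s + 1) = v ^ s * v := by
    rw [Real.rpow_add_one' hv (by linarith)]
  simp only [add_sub_cancel_right] at h
  rw [hvs] at h ⊢
  nlinarith

/-- For `s < 1` the power `s` is not Lipschitz at `0`. The extra factor `u` raises the exponent to
`s + 1 ≥ 1`, where convexity applies. It is used with `s = m - 2`, which may be less than `1`. -/
theorem abs_rpow_sub_rpow_mul_le {u v s : ℝ} (hu : 0 ≤ u) (hv : 0 ≤ v) (hs : 0 ≤ s) :
    |v ^ s - u ^ s| * u ≤ (s + 1) * max u v ^ s * |u - v| := by
  have hvs : v ^ (s + 1) = v ^ s * v := by rw [Real.rpow_add_one' hv (by linarith)]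
  have hus : u ^ (s + 1) = u ^ s * u := by rw [Real.rpow_add_one' hu (by linarith)]
  rcases le_total u v with h | h
  · have h1 := rpow_add_one_sub_le hu hv hs
    have h2 : u ^ s ≤ v ^ s := Real.rpow_le_rpow hu h hs
    rw [max_eq_right h, abs_of_nonneg (sub_nonneg.2 h2), abs_of_nonpos (by linarith)]
    have h3 : 0 ≤ v ^ s := Real.rpow_nonneg hv _
    nlinarith
  · have h1 := rpow_add_one_sub_le hv hu hs
    have h2 : v ^ s ≤ u ^ s := Real.rpow_le_rpow hv h hs
    rw [max_eq_left h, abs_of_nonpos (sub_nonpos.2 h2), abs_of_nonneg (by linarith)]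
    have h3 : 0 ≤ v ^ s := Real.rpow_nonneg hv _
    nlinarith

/-- A second-order expansion without derivatives. Convexity of `r ↦ r ^ (m / 2)` at `‖x + y‖ ^ 2`
gives the expansion with weight `‖x + y‖ ^ (m - 2)` and the term `m / 2`. Replacing that weight by
`‖x‖ ^ (m - 2)` in the linear term, so that it becomes previsible, costs `m (m - 1)`. -/
theorem norm_add_rpow_le {E : Type*} [NormedAddCommGroup E] [InnerProductSpace ℝ E]
    {m : ℝ} (hm : 2 ≤ m) (x y : E) :
    ‖x + y‖ ^ m ≤ ‖x‖ ^ m + m * (‖x‖ ^ (m - 2) * inner ℝ x y) +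
      (m * (m - 1) + m / 2) * (max ‖x‖ ‖x + y‖ ^ (m - 2) * ‖y‖ ^ 2) := by
  set u := ‖x‖ with hu
  set v := ‖x + y‖ with hv
  have hu0 : 0 ≤ u := norm_nonneg _
  have hv0 : 0 ≤ v := norm_nonneg _
  have hsq : v ^ 2 = u ^ 2 + 2 * inner ℝ x y + ‖y‖ ^ 2 := by
    rw [hv, hu, norm_add_sq_real]
  have hY := mul_rpow_sub_one_le_young (a := u ^ 2) (b := v ^ 2) (p := m / 2) (by positivity)
    (by positivity) (by linarith)
  rw [← Real.rpow_natCast u 2, ← Real.rpow_natCast v 2, ← Real.rpow_mul hu0, ← Real.rpow_mul hv0,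
    ← Real.rpow_mul hv0, Real.rpow_natCast u 2] at hY
  push_cast at hY
  rw [mul_div_cancel₀ m two_ne_zero, show (2 : ℝ) * (m / 2 - 1) = m - 2 by ring] at hY
  have hvm : v ^ m = v ^ (m - 2) * v ^ 2 := by
    rw [← Real.rpow_natCast v 2, ← Real.rpow_add_of_nonneg hv0 (by linarith) (by norm_num)]
    norm_num
  have h1 : v ^ m ≤ u ^ m + m / 2 * (v ^ (m - 2) * (v ^ 2 - u ^ 2)) := by nlinarith
  have h2 := abs_rpow_sub_rpow_mul_le hu0 hv0 (s := m - 2) (by linarith)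
  have h3 : |u - v| ≤ ‖y‖ := by
    have := abs_norm_sub_norm_le x (x + y)
    simpa [hu, hv] using this
  have hmax : v ^ (m - 2) ≤ max u v ^ (m - 2) :=
    Real.rpow_le_rpow hv0 (le_max_right _ _) (by linarith)
  have hmax0 : 0 ≤ max u v ^ (m - 2) := by positivity
  have h4 : (v ^ (m - 2) - u ^ (m - 2)) * inner ℝ x y ≤
      (m - 1) * (max u v ^ (m - 2) * ‖y‖ ^ 2) := by
    calc (v ^ (m - 2) - u ^ (m - 2)) * inner ℝ x y
        ≤ |v ^ (m - 2) - u ^ (m - 2)| * |inner ℝ x y| := by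
          rw [← abs_mul]; exact le_abs_self _
      _ ≤ |v ^ (m - 2) - u ^ (m - 2)| * (u * ‖y‖) := by
          gcongr; exact abs_real_inner_le_norm x y
      _ = |v ^ (m - 2) - u ^ (m - 2)| * u * ‖y‖ := by ring
      _ ≤ (m - 2 + 1) * max u v ^ (m - 2) * |u - v| * ‖y‖ := by gcongr
      _ ≤ (m - 2 + 1) * max u v ^ (m - 2) * ‖y‖ * ‖y‖ := by
          have : 0 ≤ m - 2 + 1 := by linarith
          gcongr
      _ = _ := by ring
  have h5 : v ^ (m - 2) * ‖y‖ ^ 2 ≤ max u v ^ (m - 2) * ‖y‖ ^ 2 := by gcongr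
  rw [hsq] at h1
  nlinarith

/-- The increment of `S ^ (m-1) * s - (m-1)/m * S ^ m`, for a running maximum `S` of `s`. -/
theorem doob_increment {m S s b : ℝ} (hm : 1 ≤ m) (hS : 0 ≤ S) (hb : 0 ≤ b) :
    m * (S ^ (m - 1) * (b - s)) ≤
      (m * (max S b ^ (m - 1) * b) - (m - 1) * max S b ^ m) -
        (m * (S ^ (m - 1) * s) - (m - 1) * S ^ m) := by
  rcases le_total b S with h | h
  · rw [max_eq_left h]; linarith
  · rw [max_eq_right h]
    have hY := mul_rpow_sub_one_le_young hb hS hm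
    have : b ^ m = b ^ (m - 1) * b := by
      rw [← Real.rpow_add_one' hb (by linarith)]; norm_num
    rw [← this]
    nlinarith

/-- Compare `x` with `c S`: in either case one of the two terms alone suffices. A small `c` makes
the `S` term absorbable. -/
theorem rpow_mul_le_of_split {S x c p q : ℝ} (hS : 0 ≤ S) (hx : 0 ≤ x) (hc : 0 < c) (hp : 0 ≤ p)
    (hq : 0 < q) :
    S ^ p * x ^ q ≤ c ^ q * S ^ (p + q) + (c ^ p)⁻¹ * x ^ (p + q) := by
  rcases le_total x (c * S) with h | h
  · have : S ^ p * x ^ q ≤ c ^ q * S ^ (p + q) := by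
      rw [Real.rpow_add_of_nonneg hS hp hq.le]
      calc S ^ p * x ^ q ≤ S ^ p * (c * S) ^ q := by gcongr
        _ = _ := by rw [Real.mul_rpow hc.le hS]; ring
    have : 0 ≤ (c ^ p)⁻¹ * x ^ (p + q) := by positivity
    linarith
  · have : S ^ p * x ^ q ≤ (c ^ p)⁻¹ * x ^ (p + q) := by
      rw [Real.rpow_add_of_nonneg hx hp hq.le]
      calc S ^ p * x ^ q = (c ^ p)⁻¹ * (c * S) ^ p * x ^ q := by
            rw [Real.mul_rpow hc.le hS]; field_simp
        _ ≤ (c ^ p)⁻¹ * x ^ p * x ^ q := by gcongr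
        _ = _ := by ring
    have : 0 ≤ c ^ q * S ^ (p + q) := by positivity
    linarith

/-! ### Martingale differences and Doob's maximal inequality -/

/-- The running maximum `max_{k ≤ n} f k`. -/
def runMax (f : ℕ → ℝ) : ℕ → ℝ
  | 0 => f 0
  | n + 1 => max (runMax f n) (f (n + 1))

theorem le_runMax (f : ℕ → ℝ) (n : ℕ) : f n ≤ runMax f n := by
  cases n with
  | zero => exact le_rfl
  | succ n => exact le_max_right _ _

theorem runMax_mono (f : ℕ → ℝ) : Monotone (runMax f) :=
  monotone_nat_of_le_succ fun _ => le_max_left _ _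

theorem runMax_le {f : ℕ → ℝ} {n : ℕ} {c : ℝ} (h : ∀ k ≤ n, f k ≤ c) : runMax f n ≤ c := by
  induction n with
  | zero => exact h 0 le_rfl
  | succ n ih => exact max_le (ih fun k hk => h k (by omega)) (h _ le_rfl)

theorem stronglyMeasurable_runMax {Ω : Type*} {mΩ : MeasurableSpace Ω} {f : ℕ → Ω → ℝ} {n : ℕ}
    (h : ∀ k ≤ n, StronglyMeasurable (f k)) :
    StronglyMeasurable fun ω => runMax (fun k => f k ω) n := by
  induction n with
  | zero => exact h 0 le_rfl
  | succ n ih => exact (ih fun k hk => h k (by omega)).sup (h _ le_rfl)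

section BDG

variable {Ω : Type*} {mΩ : MeasurableSpace Ω} {P : Measure Ω} [IsProbabilityMeasure P]
  {E : Type*} [NormedAddCommGroup E] [InnerProductSpace ℝ E] [CompleteSpace E]

theorem integral_inner_eq_zero_of_condExp_eq_zero {m₀ : MeasurableSpace Ω} (hm₀ : m₀ ≤ mΩ)
    {V X : Ω → E} (hV : StronglyMeasurable[m₀] V) (hX : Integrable X P)
    (hVX : Integrable (fun ω => inner ℝ (V ω) (X ω)) P) (h : P[X | m₀] =ᵐ[P] 0) :
    ∫ ω, inner ℝ (V ω) (X ω) ∂P = 0 := by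
  have h1 := condExp_bilin_of_stronglyMeasurable_left (innerSL ℝ) hV
    hVX hX
  rw [← integral_condExp hm₀]
  have : P[fun ω => inner ℝ (V ω) (X ω) | m₀] =ᵐ[P] 0 := by
    refine EventuallyEq.trans h1 ?_
    filter_upwards [h] with ω hω
    simp [hω]
  rw [integral_congr_ae this]
  simp

theorem integrable_of_abs_le_mul_rpow {m : ℝ} (hm : 1 ≤ m) {G f : Ω → ℝ} {K : ℝ}
    (hG : MemLp G (ENNReal.ofReal m) P) (hG0 : ∀ ω, 0 ≤ G ω) (hf : StronglyMeasurable f)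
    (h : ∀ ω, |f ω| ≤ K * G ω ^ m) : Integrable f P := by
  have h1 := hG.integrable_norm_rpow (by simp; linarith) (by simp)
  rw [ENNReal.toReal_ofReal (by linarith)] at h1
  refine (h1.const_mul K).mono' hf.aestronglyMeasurable (ae_of_all _ fun ω => ?_)
  simpa [abs_of_nonneg (hG0 ω)] using h ω

/-- The set-up of the discrete Burkholder-Davis-Gundy inequality. -/
structure IsMartingaleDiff (P : Measure Ω) (m : ℝ) (𝓖 : Filtration ℕ mΩ) (X : ℕ → Ω → E) :
    Prop where
  adapted : ∀ n, StronglyMeasurable[𝓖 n] (X n)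
  memLp : ∀ n, MemLp (X n) (ENNReal.ofReal m) P
  condExp : ∀ n, P[X (n + 1) | 𝓖 n] =ᵐ[P] 0

variable {m : ℝ} {𝓖 : Filtration ℕ mΩ} {X : ℕ → Ω → E}

/-- The partial sums of a sequence of random variables. -/
def partialSum (X : ℕ → Ω → E) (n : ℕ) (ω : Ω) : E := ∑ i ∈ Finset.range n, X i ω

/-- The maximal function of the partial sums. -/
def maxPartialSum (X : ℕ → Ω → E) (n : ℕ) (ω : Ω) : ℝ := runMax (fun k => ‖partialSum X k ω‖) n

/-- The sum of the norms, which dominates the partial sums. -/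
def normSum (X : ℕ → Ω → E) (n : ℕ) (ω : Ω) : ℝ := ∑ i ∈ Finset.range n, ‖X i ω‖

theorem partialSum_succ (n : ℕ) (ω : Ω) :
    partialSum X (n + 1) ω = partialSum X n ω + X n ω := by
  simp [partialSum, Finset.sum_range_succ]

theorem maxPartialSum_zero (ω : Ω) : maxPartialSum X 0 ω = 0 := by
  simp [maxPartialSum, runMax, partialSum]

theorem normSum_nonneg (n : ℕ) (ω : Ω) : 0 ≤ normSum X n ω :=
  Finset.sum_nonneg fun _ _ => norm_nonneg _

theorem norm_partialSum_le_normSum {n N : ℕ} (h : n ≤ N) (ω : Ω) :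
    ‖partialSum X n ω‖ ≤ normSum X N ω :=
  (norm_sum_le _ _).trans <| Finset.sum_le_sum_of_subset_of_nonneg
    (Finset.range_mono h) fun _ _ _ => norm_nonneg _

theorem norm_le_normSum {n N : ℕ} (h : n < N) (ω : Ω) : ‖X n ω‖ ≤ normSum X N ω :=
  Finset.single_le_sum (f := fun i => ‖X i ω‖) (fun _ _ => norm_nonneg _) (Finset.mem_range.2 h)

theorem norm_partialSum_le_max (n : ℕ) (ω : Ω) : ‖partialSum X n ω‖ ≤ maxPartialSum X n ω :=
  le_runMax (fun k => ‖partialSum X k ω‖) n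

theorem maxPartialSum_mono (ω : Ω) : Monotone fun n => maxPartialSum X n ω := runMax_mono _

theorem maxPartialSum_nonneg (n : ℕ) (ω : Ω) : 0 ≤ maxPartialSum X n ω :=
  (norm_nonneg (partialSum X n ω)).trans (norm_partialSum_le_max n ω)

theorem maxPartialSum_le_normSum {n N : ℕ} (h : n ≤ N) (ω : Ω) :
    maxPartialSum X n ω ≤ normSum X N ω :=
  runMax_le fun _ hk => norm_partialSum_le_normSum (hk.trans h) ω

namespace IsMartingaleDiff

theorem measurable (hX : IsMartingaleDiff P m 𝓖 X) (n : ℕ) : StronglyMeasurable (X n) :=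
  (hX.adapted n).mono (𝓖.le n)

theorem adapted_partialSum (hX : IsMartingaleDiff P m 𝓖 X) {k n : ℕ} (hk : k ≤ n + 1) :
    StronglyMeasurable[𝓖 n] (partialSum X k) := by
  refine Finset.stronglyMeasurable_fun_sum _ fun i hi => ?_
  exact (hX.adapted i).mono (𝓖.mono (by have := Finset.mem_range.1 hi; omega))

theorem measurable_partialSum (hX : IsMartingaleDiff P m 𝓖 X) (n : ℕ) :
    StronglyMeasurable (partialSum X n) :=
  (hX.adapted_partialSum (Nat.le_succ n)).mono (𝓖.le n)

theorem adapted_max (hX : IsMartingaleDiff P m 𝓖 X) {k n : ℕ} (hk : k ≤ n + 1) :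
    StronglyMeasurable[𝓖 n] (maxPartialSum X k) :=
  stronglyMeasurable_runMax fun _ hj => (hX.adapted_partialSum (hj.trans hk)).norm

theorem measurable_max (hX : IsMartingaleDiff P m 𝓖 X) (n : ℕ) :
    StronglyMeasurable (maxPartialSum X n) :=
  (hX.adapted_max (Nat.le_succ n)).mono (𝓖.le n)

theorem memLp_normSum (hX : IsMartingaleDiff P m 𝓖 X) (N : ℕ) :
    MemLp (normSum X N) (ENNReal.ofReal m) P :=
  memLp_finsetSum _ fun i _ => (hX.memLp i).norm

theorem integrable_term (hX : IsMartingaleDiff P m 𝓖 X) (hm : 2 ≤ m) (n : ℕ) :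
    Integrable (X n) P :=
  (hX.memLp n).integrable (by
    rw [ENNReal.one_le_ofReal]; linarith)

theorem integrable_of_le (hX : IsMartingaleDiff P m 𝓖 X) (hm : 2 ≤ m) (N : ℕ) {f : Ω → ℝ}
    (hf : StronglyMeasurable f) {K : ℝ} (h : ∀ ω, |f ω| ≤ K * normSum X N ω ^ m) :
    Integrable f P :=
  integrable_of_abs_le_mul_rpow (by linarith) (hX.memLp_normSum N) (normSum_nonneg N) hf h

theorem integrable_max_rpow (hX : IsMartingaleDiff P m 𝓖 X) (hm : 2 ≤ m) (n : ℕ) :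
    Integrable (fun ω => maxPartialSum X n ω ^ m) P := by
  refine hX.integrable_of_le hm n (K := 1)
    ((hX.measurable_max n).measurable.pow_const m).stronglyMeasurable fun ω => ?_
  have h0 := maxPartialSum_nonneg (X := X) n ω
  rw [abs_of_nonneg (by positivity), one_mul]
  exact Real.rpow_le_rpow h0 (maxPartialSum_le_normSum le_rfl ω) (by linarith)

theorem integrable_norm_rpow (hX : IsMartingaleDiff P m 𝓖 X) (hm : 2 ≤ m) (n : ℕ) :
    Integrable (fun ω => ‖partialSum X n ω‖ ^ m) P := by
  refine (hX.integrable_max_rpow hm n).mono'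
    ((hX.measurable_partialSum n).norm.measurable.pow_const m).aestronglyMeasurable
    (ae_of_all _ fun ω => ?_)
  rw [Real.norm_of_nonneg (by positivity)]
  exact Real.rpow_le_rpow (norm_nonneg _) (norm_partialSum_le_max n ω) (by linarith)

/-- A previsible weight of at most the right size is orthogonal to the next difference. -/
theorem integral_inner_eq_zero (hX : IsMartingaleDiff P m 𝓖 X) (hm : 2 ≤ m) (n : ℕ)
    {V : Ω → E} (hV0 : n = 0 → V = 0) (hV : ∀ k, n = k + 1 → StronglyMeasurable[𝓖 k] V)
    (hVle : ∀ ω, ‖V ω‖ ≤ normSum X (n + 1) ω ^ (m - 1)) :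
    Integrable (fun ω => inner ℝ (V ω) (X n ω)) P ∧ ∫ ω, inner ℝ (V ω) (X n ω) ∂P = 0 := by
  cases n with
  -- The first term may have any mean, so orthogonality is unavailable here; it is replaced by the
  -- vanishing of the weight, which in the applications contains the empty partial sum.
  | zero => simp [hV0 rfl]
  | succ n =>
    have hVm := hV n rfl
    have hint : Integrable (fun ω => inner ℝ (V ω) (X (n + 1) ω)) P := by
      refine hX.integrable_of_le hm (n + 2) (K := 1)
        ((hVm.mono (𝓖.le n)).inner (hX.measurable _)) fun ω => ?_
      have h0 := normSum_nonneg (X := X) (n + 2) ω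
      calc |inner ℝ (V ω) (X (n + 1) ω)| ≤ ‖V ω‖ * ‖X (n + 1) ω‖ := abs_real_inner_le_norm _ _
        _ ≤ normSum X (n + 2) ω ^ (m - 1) * normSum X (n + 2) ω := by
            gcongr
            · exact hVle ω
            · exact norm_le_normSum (by omega) ω
        _ = 1 * normSum X (n + 2) ω ^ m := by
            rw [one_mul, ← Real.rpow_add_one' h0 (by linarith)]; norm_num
    exact ⟨hint, integral_inner_eq_zero_of_condExp_eq_zero (𝓖.le n) hVm
      (hX.integrable_term hm _) hint (hX.condExp n)⟩

/-- Doob's maximal inequality in the form `c E S^m ≤ E S^(m-1) |M|` with `c = (m-1)/m`. -/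
theorem doob_aux (hX : IsMartingaleDiff P m 𝓖 X) (hm : 2 ≤ m) (n : ℕ) :
    Integrable (fun ω => maxPartialSum X n ω ^ (m - 1) * ‖partialSum X n ω‖) P ∧
    (m - 1) * ∫ ω, maxPartialSum X n ω ^ m ∂P ≤
      m * ∫ ω, maxPartialSum X n ω ^ (m - 1) * ‖partialSum X n ω‖ ∂P := by
  have hint : ∀ n, Integrable (fun ω => maxPartialSum X n ω ^ (m - 1) * ‖partialSum X n ω‖) P := by
    intro n
    refine (hX.integrable_max_rpow hm n).mono'
      (((hX.measurable_max n).measurable.pow_const _).aestronglyMeasurable.mul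
        (hX.measurable_partialSum n).norm.aestronglyMeasurable) (ae_of_all _ fun ω => ?_)
    have h0 := maxPartialSum_nonneg (X := X) n ω
    rw [Real.norm_of_nonneg (by positivity)]
    calc _ ≤ maxPartialSum X n ω ^ (m - 1) * maxPartialSum X n ω := by
          gcongr; exact norm_partialSum_le_max n ω
      _ = _ := by rw [← Real.rpow_add_one' h0 (by linarith)]; norm_num
  refine ⟨hint n, ?_⟩
  induction n with
  | zero =>
    have : m ≠ 0 := by linarith
    have h1 : m - 1 ≠ 0 := by linarith
    simp [maxPartialSum_zero, Real.zero_rpow this, Real.zero_rpow h1]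
  | succ n ih =>
    -- `V` is `S ^ (m - 1)` times the gradient of the norm at the current partial sum. By convexity
    -- of the norm, the increment of `m S ^ (m-1) |M| - (m-1) S ^ m` is at least `m ⟪V, X n⟫`, which
    -- has mean zero, so the expectation of this quantity does not decrease from its initial value
    -- `0`.
    let V : Ω → E := fun ω =>
      (maxPartialSum X n ω ^ (m - 1) * ‖partialSum X n ω‖⁻¹) • partialSum X n ω
    have hV : Integrable (fun ω => inner ℝ (V ω) (X n ω)) P ∧
        ∫ ω, inner ℝ (V ω) (X n ω) ∂P = 0 := by
      refine hX.integral_inner_eq_zero hm n ?_ ?_ ?_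
      · rintro rfl; funext ω; simp [V, partialSum]
      · rintro k rfl
        have h1 := hX.adapted_max (le_refl (k + 1))
        have h2 := hX.adapted_partialSum (le_refl (k + 1))
        exact (((h1.measurable.pow_const _).mul h2.norm.measurable.inv).stronglyMeasurable).smul h2
      · intro ω
        have h0 := maxPartialSum_nonneg (X := X) n ω
        have h1 : ‖partialSum X n ω‖⁻¹ * ‖partialSum X n ω‖ ≤ 1 := by
          rcases eq_or_ne ‖partialSum X n ω‖ 0 with h | h
          · simp [h]
          · rw [inv_mul_cancel₀ h]
        calc ‖V ω‖ = maxPartialSum X n ω ^ (m - 1) *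
              (‖partialSum X n ω‖⁻¹ * ‖partialSum X n ω‖) := by
              simp only [V]
              rw [norm_smul, Real.norm_of_nonneg (by positivity), mul_assoc]
          _ ≤ maxPartialSum X n ω ^ (m - 1) * 1 := by gcongr
          _ ≤ _ := by
              rw [mul_one]
              exact Real.rpow_le_rpow h0 (maxPartialSum_le_normSum (Nat.le_succ n) ω) (by linarith)
    have hpt : ∀ ω, m * inner ℝ (V ω) (X n ω) ≤
        (m * (maxPartialSum X (n + 1) ω ^ (m - 1) * ‖partialSum X (n + 1) ω‖) -
          (m - 1) * maxPartialSum X (n + 1) ω ^ m) -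
        (m * (maxPartialSum X n ω ^ (m - 1) * ‖partialSum X n ω‖) -
          (m - 1) * maxPartialSum X n ω ^ m) := by
      intro ω
      have h0 := maxPartialSum_nonneg (X := X) n ω
      refine le_trans ?_ (doob_increment (S := maxPartialSum X n ω) (s := ‖partialSum X n ω‖)
        (b := ‖partialSum X (n + 1) ω‖) (by linarith) h0 (norm_nonneg _))
      have h1 : inner ℝ (V ω) (X n ω) ≤ maxPartialSum X n ω ^ (m - 1) *
          (‖partialSum X (n + 1) ω‖ - ‖partialSum X n ω‖) := by
        simp only [V]
        rw [real_inner_smul_left, mul_assoc]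
        refine mul_le_mul_of_nonneg_left ?_ (by positivity)
        rcases eq_or_ne (partialSum X n ω) 0 with h | h
        · simp [h]
        · have hn : 0 < ‖partialSum X n ω‖ := norm_pos_iff.2 h
          rw [inv_mul_le_iff₀ hn, mul_sub]
          have h2 := real_inner_le_norm (partialSum X n ω) (partialSum X (n + 1) ω)
          rw [partialSum_succ, inner_add_right, real_inner_self_eq_norm_sq] at h2
          rw [partialSum_succ]
          nlinarith
      have : 0 ≤ m := by linarith
      exact mul_le_mul_of_nonneg_left h1 this
    have hI1 := (hint (n + 1)).const_mul m
    have hI2 := (hX.integrable_max_rpow hm (n + 1)).const_mul (m - 1)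
    have hI3 := (hint n).const_mul m
    have hI4 := (hX.integrable_max_rpow hm n).const_mul (m - 1)
    have := integral_mono (hV.1.const_mul m) ((hI1.sub hI2).sub (hI3.sub hI4)) hpt
    rw [integral_sub' (hI1.sub hI2) (hI3.sub hI4), integral_sub' hI1 hI2, integral_sub' hI3 hI4,
      integral_const_mul, integral_const_mul, integral_const_mul, integral_const_mul,
      integral_const_mul, hV.2] at this
    linarith

/-- Doob's maximal inequality, with a constant that is not the best one. -/
theorem doob (hX : IsMartingaleDiff P m 𝓖 X) (hm : 2 ≤ m) (n : ℕ) :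
    ∫ ω, maxPartialSum X n ω ^ m ∂P ≤ 4 ^ m * ∫ ω, ‖partialSum X n ω‖ ^ m ∂P := by
  obtain ⟨hint, h⟩ := hX.doob_aux hm n
  have hpt : ∀ ω, maxPartialSum X n ω ^ (m - 1) * ‖partialSum X n ω‖ ≤
      (4 : ℝ)⁻¹ * maxPartialSum X n ω ^ m + 4 ^ (m - 1) * ‖partialSum X n ω‖ ^ m := by
    -- With `c = 1/4` the split gives `(m - 1) a ≤ m (a / 4 + b)`, and `m ≥ 2` turns this into `a ≤
    -- 4 b`.
    intro ω
    have := rpow_mul_le_of_split (maxPartialSum_nonneg (X := X) n ω)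
      (norm_nonneg (partialSum X n ω)) (c := 4⁻¹) (by norm_num) (p := m - 1) (by linarith)
      one_pos
    simpa [Real.inv_rpow] using this
  have h2 := integral_mono hint (((hX.integrable_max_rpow hm n).const_mul _).add
    ((hX.integrable_norm_rpow hm n).const_mul _)) hpt
  rw [integral_add' ((hX.integrable_max_rpow hm n).const_mul _)
    ((hX.integrable_norm_rpow hm n).const_mul _), integral_const_mul, integral_const_mul] at h2
  have h4 : (4 : ℝ) ^ m = 4 ^ (m - 1) * 4 := by
    rw [← Real.rpow_add_one (by norm_num)]; norm_num
  have hS : 0 ≤ ∫ ω, maxPartialSum X n ω ^ m ∂P :=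
    integral_nonneg fun ω => Real.rpow_nonneg (maxPartialSum_nonneg n ω) _
  rw [h4]
  set a := ∫ ω, maxPartialSum X n ω ^ m ∂P
  set b := (4 : ℝ) ^ (m - 1) * ∫ ω, ‖partialSum X n ω‖ ^ m ∂P
  have h5 : (m - 1) * a ≤ m * (4⁻¹ * a + b) := h.trans (by gcongr)
  have h6 : 0 ≤ b := mul_nonneg (by positivity) (integral_nonneg fun ω => by positivity)
  nlinarith

end IsMartingaleDiff

end BDG

/-! ### The square function and the BDG inequality -/

section BDG

variable {Ω : Type*} {mΩ : MeasurableSpace Ω} {P : Measure Ω} [IsProbabilityMeasure P]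
  {E : Type*} [NormedAddCommGroup E] [InnerProductSpace ℝ E] [CompleteSpace E]
  {m : ℝ} {𝓖 : Filtration ℕ mΩ} {X : ℕ → Ω → E}

/-- The square function of a sequence of random variables. -/
noncomputable def squareFun (X : ℕ → Ω → E) (n : ℕ) (ω : Ω) : ℝ := √(∑ i ∈ Finset.range n, ‖X i ω‖ ^ 2)

theorem squareFun_nonneg (n : ℕ) (ω : Ω) : 0 ≤ squareFun X n ω := Real.sqrt_nonneg _

theorem sq_squareFun (n : ℕ) (ω : Ω) :
    squareFun X n ω ^ 2 = ∑ i ∈ Finset.range n, ‖X i ω‖ ^ 2 :=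
  Real.sq_sqrt (Finset.sum_nonneg fun _ _ => by positivity)

theorem squareFun_le_normSum (n : ℕ) (ω : Ω) : squareFun X n ω ≤ normSum X n ω :=
  Real.sqrt_le_iff.2 ⟨normSum_nonneg n ω, Finset.sum_sq_le_sq_sum_of_nonneg fun _ _ => norm_nonneg _⟩

namespace IsMartingaleDiff

theorem measurable_squareFun (hX : IsMartingaleDiff P m 𝓖 X) (n : ℕ) :
    StronglyMeasurable (squareFun X n) :=
  Real.continuous_sqrt.comp_stronglyMeasurable <|
    Finset.stronglyMeasurable_fun_sum _ fun i _ => (hX.measurable i).norm.pow 2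

theorem integrable_squareFun_rpow (hX : IsMartingaleDiff P m 𝓖 X) (hm : 2 ≤ m) (n : ℕ) :
    Integrable (fun ω => squareFun X n ω ^ m) P := by
  refine hX.integrable_of_le hm n (K := 1)
    ((hX.measurable_squareFun n).measurable.pow_const m).stronglyMeasurable fun ω => ?_
  have h0 := squareFun_nonneg (X := X) n ω
  rw [abs_of_nonneg (by positivity), one_mul]
  exact Real.rpow_le_rpow h0 (squareFun_le_normSum n ω) (by linarith)

theorem integrable_max_mul (hX : IsMartingaleDiff P m 𝓖 X) (hm : 2 ≤ m) {n N : ℕ} (hn : n < N) :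
    Integrable (fun ω => maxPartialSum X N ω ^ (m - 2) * ‖X n ω‖ ^ 2) P := by
  refine hX.integrable_of_le hm N (K := 1)
    (((hX.measurable_max N).measurable.pow_const _).stronglyMeasurable.mul
      ((hX.measurable n).norm.pow 2)) fun ω => ?_
  have h0 := maxPartialSum_nonneg (X := X) N ω
  have h1 := normSum_nonneg (X := X) N ω
  rw [abs_of_nonneg (by positivity), one_mul]
  calc _ ≤ normSum X N ω ^ (m - 2) * normSum X N ω ^ 2 := by
        gcongr
        · exact maxPartialSum_le_normSum le_rfl ω
        · exact norm_le_normSum hn ω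
    _ = _ := by
        rw [← Real.rpow_natCast, ← Real.rpow_add_of_nonneg h1 (by linarith) (by norm_num)]
        norm_num

/-- Expand `‖M + X‖ ^ m` to second order: the linear term is a previsible weight against the next
difference and integrates to zero, and the maximum in the remainder is bounded by the maximal
function at the final time, the same weight for every `n`. -/
theorem integral_norm_rpow_succ_le (hX : IsMartingaleDiff P m 𝓖 X) (hm : 2 ≤ m) {n N : ℕ}
    (hn : n < N) :
    ∫ ω, ‖partialSum X (n + 1) ω‖ ^ m ∂P ≤ ∫ ω, ‖partialSum X n ω‖ ^ m ∂P +
      (m * (m - 1) + m / 2) * ∫ ω, maxPartialSum X N ω ^ (m - 2) * ‖X n ω‖ ^ 2 ∂P := by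
  let V : Ω → E := fun ω => ‖partialSum X n ω‖ ^ (m - 2) • partialSum X n ω
  have hV : Integrable (fun ω => inner ℝ (V ω) (X n ω)) P ∧
      ∫ ω, inner ℝ (V ω) (X n ω) ∂P = 0 := by
    refine hX.integral_inner_eq_zero hm n ?_ ?_ ?_
    · rintro rfl; funext ω; simp [V, partialSum]
    · rintro k rfl
      have h2 := hX.adapted_partialSum (le_refl (k + 1))
      exact ((h2.norm.measurable.pow_const _).stronglyMeasurable).smul h2
    · intro ω
      calc ‖V ω‖ = ‖partialSum X n ω‖ ^ (m - 2) * ‖partialSum X n ω‖ := by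
            simp only [V]
            rw [norm_smul, Real.norm_of_nonneg (by positivity)]
        _ = ‖partialSum X n ω‖ ^ (m - 1) := by
            rw [← Real.rpow_add_one' (norm_nonneg _) (by linarith)]
            ring_nf
        _ ≤ _ := Real.rpow_le_rpow (norm_nonneg _) (norm_partialSum_le_normSum (Nat.le_succ n) ω)
            (by linarith)
  have hC : 0 ≤ m * (m - 1) + m / 2 := by nlinarith
  have hpt : ∀ ω, ‖partialSum X (n + 1) ω‖ ^ m ≤ ‖partialSum X n ω‖ ^ m +
      m * inner ℝ (V ω) (X n ω) +
      (m * (m - 1) + m / 2) * (maxPartialSum X N ω ^ (m - 2) * ‖X n ω‖ ^ 2) := by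
    intro ω
    rw [partialSum_succ]
    refine (norm_add_rpow_le hm _ _).trans ?_
    simp only [V, real_inner_smul_left]
    gcongr
    refine max_le ?_ ?_
    · exact (norm_partialSum_le_max n ω).trans (maxPartialSum_mono ω hn.le)
    · rw [← partialSum_succ]
      exact (norm_partialSum_le_max (n + 1) ω).trans (maxPartialSum_mono ω hn)
  have hI1 := hX.integrable_norm_rpow hm n
  have hI2 := hV.1.const_mul m
  have hI3 := (hX.integrable_max_mul hm hn).const_mul (m * (m - 1) + m / 2)
  have := integral_mono (hX.integrable_norm_rpow hm (n + 1)) ((hI1.add hI2).add hI3) hpt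
  rw [integral_add' (hI1.add hI2) hI3, integral_add' hI1 hI2, integral_const_mul,
    integral_const_mul, hV.2] at this
  linarith

theorem integral_norm_rpow_le (hX : IsMartingaleDiff P m 𝓖 X) (hm : 2 ≤ m) (N : ℕ) :
    ∫ ω, ‖partialSum X N ω‖ ^ m ∂P ≤
      (m * (m - 1) + m / 2) *
        ∫ ω, maxPartialSum X N ω ^ (m - 2) * squareFun X N ω ^ (2 : ℝ) ∂P := by
  have key : ∀ n ≤ N, ∫ ω, ‖partialSum X n ω‖ ^ m ∂P ≤ (m * (m - 1) + m / 2) *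
      ∑ i ∈ Finset.range n, ∫ ω, maxPartialSum X N ω ^ (m - 2) * ‖X i ω‖ ^ 2 ∂P := by
    intro n
    induction n with
    | zero =>
      have : m ≠ 0 := by linarith
      simp [partialSum, Real.zero_rpow this]
    | succ n ih =>
      intro hn
      have h1 := hX.integral_norm_rpow_succ_le hm (Nat.lt_of_succ_le hn)
      have h2 := ih (by omega)
      rw [Finset.sum_range_succ, mul_add]
      linarith
  refine (key N le_rfl).trans_eq ?_
  rw [← integral_finsetSum _ fun i hi => hX.integrable_max_mul hm (Finset.mem_range.1 hi)]
  congr 2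
  funext ω
  rw [← Finset.mul_sum, Real.rpow_two, sq_squareFun]

/-- The constant of the integrated Burkholder-Davis-Gundy inequality. -/
theorem exists_integral_norm_rpow_le (hm : 2 ≤ m) : ∃ K : ℝ, 0 ≤ K ∧
    ∀ (Ω : Type u) (mΩ : MeasurableSpace Ω) (P : Measure Ω) (_ : IsProbabilityMeasure P)
      (𝓖 : Filtration ℕ mΩ) (X : ℕ → Ω → E), IsMartingaleDiff P m 𝓖 X → ∀ N,
      ∫ ω, ‖partialSum X N ω‖ ^ m ∂P ≤ K * ∫ ω, squareFun X N ω ^ m ∂P := by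
  set C := m * (m - 1) + m / 2 with hC
  have hC0 : 0 < C := by rw [hC]; nlinarith
  -- Chosen so that, after Doob's inequality, the maximal function reappears on the right with
  -- coefficient `1/2` and can be absorbed; its `m`-th moment is finite.
  set c := √((2 * (4 ^ m * C))⁻¹) with hc
  have hc0 : 0 < c := Real.sqrt_pos.2 (by positivity)
  have hc2 : c ^ (2 : ℝ) = (2 * (4 ^ m * C))⁻¹ := by
    rw [Real.rpow_two, hc, Real.sq_sqrt (by positivity)]
  refine ⟨2 * (4 ^ m * C) * (c ^ (m - 2))⁻¹, by positivity, ?_⟩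
  intro Ω mΩ P _ 𝓖 X hX N
  have hI1 := (hX.integrable_max_rpow hm N).const_mul (c ^ (2 : ℝ))
  have hI2 := (hX.integrable_squareFun_rpow hm N).const_mul ((c ^ (m - 2))⁻¹)
  have hpt : ∀ ω, maxPartialSum X N ω ^ (m - 2) * squareFun X N ω ^ (2 : ℝ) ≤
      c ^ (2 : ℝ) * maxPartialSum X N ω ^ m + (c ^ (m - 2))⁻¹ * squareFun X N ω ^ m := by
    intro ω
    have := rpow_mul_le_of_split (maxPartialSum_nonneg (X := X) N ω)
      (squareFun_nonneg (X := X) N ω) hc0 (p := m - 2) (by linarith) two_pos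
    simpa using this
  have hI : Integrable (fun ω => maxPartialSum X N ω ^ (m - 2) * squareFun X N ω ^ (2 : ℝ)) P := by
    refine (hI1.add hI2).mono' ?_ (ae_of_all _ fun ω => ?_)
    · exact (((hX.measurable_max N).measurable.pow_const _).mul
        ((hX.measurable_squareFun N).measurable.pow_const _)).aestronglyMeasurable
    · have h0 := maxPartialSum_nonneg (X := X) N ω
      have h1 := squareFun_nonneg (X := X) N ω
      rw [Real.norm_of_nonneg (by positivity)]
      exact hpt ω
  have h1 := integral_mono hI (hI1.add hI2) hpt
  rw [integral_add' hI1 hI2, integral_const_mul, integral_const_mul, hc2] at h1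
  have h2 := hX.integral_norm_rpow_le hm N
  have h3 := hX.doob hm N
  have h4 : ∫ ω, ‖partialSum X N ω‖ ^ m ∂P ≤ ∫ ω, maxPartialSum X N ω ^ m ∂P :=
    integral_mono (hX.integrable_norm_rpow hm N) (hX.integrable_max_rpow hm N) fun ω =>
      Real.rpow_le_rpow (norm_nonneg _) (norm_partialSum_le_max N ω) (by linarith)
  refine h4.trans ?_
  set a := ∫ ω, maxPartialSum X N ω ^ m ∂P
  set q := (c ^ (m - 2))⁻¹ * ∫ ω, squareFun X N ω ^ m ∂P with hq
  have h5 : a ≤ 4 ^ m * (C * ((2 * (4 ^ m * C))⁻¹ * a + q)) := by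
    refine h3.trans ?_
    gcongr
    refine h2.trans ?_
    gcongr
  have h6 : 4 ^ m * (C * ((2 * (4 ^ m * C))⁻¹ * a + q)) = a / 2 + 4 ^ m * C * q := by
    field_simp
  rw [h6] at h5
  rw [mul_assoc, ← hq]
  linarith

end IsMartingaleDiff

theorem eLpNorm_sq_rpow_half {m : ℝ} (hm : 2 ≤ m) (f : Ω → ℝ) :
    eLpNorm (fun ω => ‖f ω‖ ^ 2) (ENNReal.ofReal (m / 2)) P ^ (1 / 2 : ℝ) =
      eLpNorm f (ENNReal.ofReal m) P := by
  have h := eLpNorm_norm_rpow (p := ENNReal.ofReal (m / 2)) (μ := P) f two_pos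
  rw [← ENNReal.ofReal_mul (by linarith), div_mul_cancel₀ _ two_ne_zero] at h
  simp only [Real.rpow_two] at h
  rw [h, ← ENNReal.rpow_mul]
  norm_num

theorem eLpNorm_sum_sq_rpow_half {m : ℝ} (hm : 2 ≤ m) (X : ℕ → Ω → E) (N : ℕ) :
    eLpNorm (fun ω => ∑ n ∈ Finset.range N, ‖X n ω‖ ^ 2) (ENNReal.ofReal (m / 2)) P
      ^ (1 / 2 : ℝ) = eLpNorm (squareFun X N) (ENNReal.ofReal m) P := by
  rw [← eLpNorm_sq_rpow_half hm]
  simp_rw [Real.norm_eq_abs, sq_abs, sq_squareFun]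

end BDG

theorem exists_isBDGConstant {m : ℝ} (hm : 2 ≤ m) (d : ℕ) :
    ∃ c : ℝ, 0 ≤ c ∧ IsBDGConstant.{u} m d c := by
  obtain ⟨K, hK, h⟩ := IsMartingaleDiff.exists_integral_norm_rpow_le.{u}
    (E := EuclideanSpace ℝ (Fin d)) hm
  refine ⟨K ^ m⁻¹, by positivity, ?_⟩
  intro Ω mΩ P _ 𝓖 X h1 h2 h3 N
  have hX : IsMartingaleDiff P m 𝓖 X := ⟨h1, h2, h3⟩
  have hm0 : ENNReal.ofReal m ≠ 0 := by simp; linarith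
  have hmr : (ENNReal.ofReal m).toReal = m := ENNReal.toReal_ofReal (by linarith)
  have hsq : MemLp (squareFun X N) (ENNReal.ofReal m) P :=
    (hX.memLp_normSum N).mono (hX.measurable_squareFun N).aestronglyMeasurable <|
      ae_of_all _ fun ω => by
        rw [Real.norm_of_nonneg (squareFun_nonneg _ _), Real.norm_of_nonneg (normSum_nonneg _ _)]
        exact squareFun_le_normSum N ω
  have hps : MemLp (partialSum X N) (ENNReal.ofReal m) P := memLp_finsetSum _ fun i _ => h2 i
  have hS : 0 ≤ ∫ ω, squareFun X N ω ^ m ∂P :=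
    integral_nonneg fun ω => Real.rpow_nonneg (squareFun_nonneg N ω) _
  rw [eLpNorm_sum_sq_rpow_half hm]
  change eLpNorm (partialSum X N) _ P ≤ _
  rw [hps.eLpNorm_eq_integral_rpow_norm hm0 (by simp),
    hsq.eLpNorm_eq_integral_rpow_norm hm0 (by simp), hmr, ← ENNReal.ofReal_mul (by positivity)]
  refine ENNReal.ofReal_le_ofReal ?_
  simp_rw [fun ω => Real.norm_of_nonneg (squareFun_nonneg (X := X) N ω)]
  rw [← Real.mul_rpow hK hS]
  exact Real.rpow_le_rpow (integral_nonneg fun ω => by positivity) (h Ω mΩ P ‹_› 𝓖 X hX N)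
    (by positivity)

theorem bdgConst_nonneg (m : ℝ) (d : ℕ) : 0 ≤ bdgConst.{u} m d :=
  Real.sInf_nonneg fun _ h => h.1

/-- The infimum in the definition of `bdgConst` is attained. -/
theorem isBDGConstant_bdgConst {m : ℝ} (hm : 2 ≤ m) (d : ℕ) :
    IsBDGConstant.{u} m d (bdgConst.{u} m d) := by
  intro Ω mΩ P _ 𝓖 X h1 h2 h3 N
  have hX : IsMartingaleDiff P m 𝓖 X := ⟨h1, h2, h3⟩
  set R := eLpNorm (fun ω => ∑ n ∈ Finset.range N, ‖X n ω‖ ^ 2) (ENNReal.ofReal (m / 2)) P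
      ^ (1 / 2 : ℝ) with hR
  have hRtop : R ≠ ∞ := by
    rw [hR, eLpNorm_sum_sq_rpow_half hm]
    refine ((hX.memLp_normSum N).mono (hX.measurable_squareFun N).aestronglyMeasurable <|
      ae_of_all _ fun ω => ?_).2.ne
    rw [Real.norm_of_nonneg (squareFun_nonneg _ _), Real.norm_of_nonneg (normSum_nonneg _ _)]
    exact squareFun_le_normSum N ω
  -- Constants above the infimum are admissible, and since `R` is finite the bound passes to the
  -- limit `c ↓ bdgConst`.
  have hlim : Tendsto (fun c : ℝ => ENNReal.ofReal c * R) (𝓝[>] (bdgConst.{u} m d))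
      (𝓝 (ENNReal.ofReal (bdgConst.{u} m d) * R)) :=
    ENNReal.Tendsto.mul_const
      ((ENNReal.continuous_ofReal.tendsto _).mono_left nhdsWithin_le_nhds) (Or.inr hRtop)
  refine ge_of_tendsto hlim ?_
  filter_upwards [self_mem_nhdsWithin] with c hc
  obtain ⟨c', ⟨-, hc'⟩, hlt⟩ := exists_lt_of_csInf_lt (exists_isBDGConstant.{u} hm d) hc
  refine (hc' Ω mΩ P ‹_› 𝓖 X h1 h2 h3 N).trans ?_
  gcongr

/-! ### Sums of variables whose conditional expectations decay with the lag -/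

theorem Finset.sum_range_mul_eq {M : Type*} [AddCommMonoid M] (f : ℕ → M) (N q : ℕ) :
    ∑ j ∈ Finset.range (N * q), f j =
      ∑ k ∈ Finset.range N, ∑ r ∈ Finset.range q, f (k * q + r) := by
  induction N with
  | zero => simp
  | succ N ih => rw [Nat.succ_mul, Finset.sum_range_add, ih, Finset.sum_range_succ]

section Discrete

variable {Ω : Type u} {mΩ : MeasurableSpace Ω} {P : Measure Ω} [IsProbabilityMeasure P]
  {d : ℕ} {m κ : ℝ}

theorem one_le_ofReal_of_two_le {m : ℝ} (hm : 2 ≤ m) : 1 ≤ ENNReal.ofReal m := by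
  rw [ENNReal.one_le_ofReal]; linarith

/-- Since `m / 2 ≥ 1`, the triangle inequality in `L_{m/2}` for the squares bounds the square
function by `b N ^ (1/2)`. -/
theorem IsBDGConstant.eLpNorm_sum_le (hκ : IsBDGConstant.{u} m d κ) (hm : 2 ≤ m) (hκ0 : 0 ≤ κ)
    {𝓖 : Filtration ℕ mΩ} {X : ℕ → Ω → EuclideanSpace ℝ (Fin d)} {b : ℝ} (hb : 0 ≤ b)
    (hX : ∀ n, StronglyMeasurable[𝓖 n] (X n))
    (hXb : ∀ n, eLpNorm (X n) (ENNReal.ofReal m) P ≤ ENNReal.ofReal b)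
    (hX0 : ∀ n, P[X (n + 1) | 𝓖 n] =ᵐ[P] 0) (N : ℕ) :
    eLpNorm (fun ω => ∑ n ∈ Finset.range N, X n ω) (ENNReal.ofReal m) P ≤
      ENNReal.ofReal (κ * (b * (N : ℝ) ^ (1 / 2 : ℝ))) := by
  have hmeas : ∀ n, StronglyMeasurable (X n) := fun n => (hX n).mono (𝓖.le n)
  refine (hκ Ω mΩ P ‹_› 𝓖 X hX (fun n => ⟨(hmeas n).aestronglyMeasurable,
    (hXb n).trans_lt ENNReal.ofReal_lt_top⟩) hX0 N).trans ?_
  rw [ENNReal.ofReal_mul hκ0]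
  gcongr
  have h1 : eLpNorm (fun ω => ∑ n ∈ Finset.range N, ‖X n ω‖ ^ 2) (ENNReal.ofReal (m / 2)) P ≤
      ENNReal.ofReal (b ^ 2 * N) := by
    have h2 := MeasureTheory.eLpNorm_sum_le (μ := P) (p := ENNReal.ofReal (m / 2))
      (f := fun n ω => ‖X n ω‖ ^ 2) (s := Finset.range N)
      (fun n _ => ((hmeas n).norm.pow 2).aestronglyMeasurable)
      (by rw [ENNReal.one_le_ofReal]; linarith)
    have h3 : (∑ n ∈ Finset.range N, fun ω => ‖X n ω‖ ^ 2) =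
        fun ω => ∑ n ∈ Finset.range N, ‖X n ω‖ ^ 2 := by funext ω; simp
    rw [h3] at h2
    refine h2.trans ?_
    have h4 : ∀ n ∈ Finset.range N,
        eLpNorm (fun ω => ‖X n ω‖ ^ 2) (ENNReal.ofReal (m / 2)) P ≤ ENNReal.ofReal (b ^ 2) := by
      intro n _
      have h := eLpNorm_norm_rpow (p := ENNReal.ofReal (m / 2)) (μ := P) (X n) two_pos
      rw [← ENNReal.ofReal_mul (by linarith), div_mul_cancel₀ _ two_ne_zero] at h
      simp only [Real.rpow_two, ENNReal.rpow_two] at h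
      rw [h, ENNReal.ofReal_pow hb]
      gcongr
      exact hXb n
    refine (Finset.sum_le_sum h4).trans_eq ?_
    rw [Finset.sum_const, Finset.card_range, nsmul_eq_mul, mul_comm,
      ENNReal.ofReal_mul (by positivity), ENNReal.ofReal_natCast]
  calc _ ≤ ENNReal.ofReal (b ^ 2 * N) ^ (1 / 2 : ℝ) := by gcongr
    _ = _ := by
      rw [ENNReal.ofReal_rpow_of_nonneg (by positivity) (by norm_num),
        Real.mul_rpow (by positivity) (by positivity), ← Real.rpow_natCast b 2, ← Real.rpow_mul hb]
      norm_num

theorem condExp_sub_condExp_self {m₀ : MeasurableSpace Ω} (hm₀ : m₀ ≤ mΩ)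
    {E : Type*} [NormedAddCommGroup E] [NormedSpace ℝ E] [CompleteSpace E] {f : Ω → E}
    (hf : Integrable f P) : P[f - P[f | m₀] | m₀] =ᵐ[P] 0 := by
  refine (condExp_sub hf integrable_condExp m₀).trans ?_
  rw [condExp_of_stronglyMeasurable hm₀ stronglyMeasurable_condExp integrable_condExp, sub_self]

/-- A sequence that is centered with lag `L` is a sum of `L + 1` martingale differences. -/
theorem IsBDGConstant.eLpNorm_sum_le_of_lag (hκ : IsBDGConstant.{u} m d κ) (hm : 2 ≤ m)
    (hκ0 : 0 ≤ κ) {𝓖 : Filtration ℕ mΩ} {Z : ℕ → Ω → EuclideanSpace ℝ (Fin d)} {b : ℝ}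
    (hb : 0 ≤ b) (L : ℕ) (hZ : ∀ j, StronglyMeasurable[𝓖 (j + 1)] (Z j))
    (hZb : ∀ j, eLpNorm (Z j) (ENNReal.ofReal m) P ≤ ENNReal.ofReal b)
    (hZ0 : ∀ j, P[Z (j + L) | 𝓖 j] =ᵐ[P] 0) (N : ℕ) :
    eLpNorm (fun ω => ∑ j ∈ Finset.range N, Z j ω) (ENNReal.ofReal m) P ≤
      ENNReal.ofReal (κ * ((L + 1) * b * (N : ℝ) ^ (1 / 2 : ℝ))) := by
  classical
  -- Extension by zero lets every residue class modulo `L + 1` be summed over the same `N` indices.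
  -- Within a class, consecutive indices are `L + 1` apart, which is exactly lag `L` after `Z` at
  -- `j` has become `𝓖 (j + 1)`-measurable.
  set Z' : ℕ → Ω → EuclideanSpace ℝ (Fin d) := fun j => if j < N then Z j else 0 with hZ'
  have hsum : (fun ω => ∑ j ∈ Finset.range N, Z j ω) =
      ∑ r ∈ Finset.range (L + 1), fun ω => ∑ k ∈ Finset.range N, Z' (k * (L + 1) + r) ω := by
    funext ω
    rw [Finset.sum_apply, Finset.sum_comm, ← Finset.sum_range_mul_eq (fun j => Z' j ω)]
    have h1 : N ≤ N * (L + 1) := Nat.le_mul_of_pos_right _ (Nat.succ_pos _)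
    rw [← Finset.sum_subset (Finset.range_mono h1)]
    · exact Finset.sum_congr rfl fun j hj => by simp [hZ', Finset.mem_range.1 hj]
    · intro j _ hj
      simp only [Finset.mem_range] at hj
      simp [hZ', hj]
  have hZ'm : ∀ j, StronglyMeasurable[𝓖 (j + 1)] (Z' j) := by
    intro j
    by_cases h : j < N
    · simpa [hZ', h] using hZ j
    · simpa [hZ', h] using stronglyMeasurable_zero
  rw [hsum]
  refine (MeasureTheory.eLpNorm_sum_le (fun r _ => (Finset.stronglyMeasurable_fun_sum _ fun k _ =>
    (hZ'm _).mono (𝓖.le _)).aestronglyMeasurable) (one_le_ofReal_of_two_le hm)).trans ?_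
  have hr : ∀ r ∈ Finset.range (L + 1), eLpNorm (fun ω => ∑ k ∈ Finset.range N,
      Z' (k * (L + 1) + r) ω) (ENNReal.ofReal m) P ≤
        ENNReal.ofReal (κ * (b * (N : ℝ) ^ (1 / 2 : ℝ))) := by
    intro r _
    let 𝓗 : Filtration ℕ mΩ :=
      { seq := fun k => 𝓖 (k * (L + 1) + r + 1)
        mono' := fun a c hac => 𝓖.mono (by gcongr)
        le' := fun k => 𝓖.le _ }
    refine hκ.eLpNorm_sum_le hm hκ0 (𝓖 := 𝓗) (X := fun k => Z' (k * (L + 1) + r)) hb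
      (fun k => hZ'm _) (fun k => ?_) (fun k => ?_) N
    · by_cases h : k * (L + 1) + r < N
      · simpa [hZ', h] using hZb _
      · simp [hZ', h]
    · have h1 : (k + 1) * (L + 1) + r = k * (L + 1) + r + 1 + L := by ring
      change P[Z' ((k + 1) * (L + 1) + r) | 𝓖 (k * (L + 1) + r + 1)] =ᵐ[P] 0
      rw [h1]
      by_cases h : k * (L + 1) + r + 1 + L < N
      · simpa [hZ', h] using hZ0 _
      · simp [hZ', h]
  refine (Finset.sum_le_sum hr).trans_eq ?_
  rw [Finset.sum_const, Finset.card_range, nsmul_eq_mul, ← ENNReal.ofReal_natCast,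
    ← ENNReal.ofReal_mul (by positivity)]
  congr 1
  push_cast
  ring

/-- The sum of `2 ^ n` random variables of size `b` whose conditional expectations decay like
`g j ^ (-α)` in the lag `j`, for lags of at least `L`. -/
theorem IsBDGConstant.eLpNorm_sum_two_pow_le (hκ : IsBDGConstant.{u} m d κ) (hm : 2 ≤ m)
    (hκ0 : 0 ≤ κ) {L : ℕ} (hL : 1 ≤ L) {α θ D : ℝ} (hα : 0 ≤ α) (hθ : 1 / 2 ≤ θ) (hD0 : 0 ≤ D)
    (hD : 4 * ((L : ℝ) + 1) ≤ D * (2 ^ θ - 2 ^ (1 - α))) (n : ℕ) {𝓖 : Filtration ℕ mΩ}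
    {R : ℕ → Ω → EuclideanSpace ℝ (Fin d)} {b g : ℝ} (hb : 0 ≤ b) (hg : 0 ≤ g)
    (hR : ∀ j, StronglyMeasurable[𝓖 (j + 1)] (R j))
    (hRb : ∀ j, eLpNorm (R j) (ENNReal.ofReal m) P ≤ ENNReal.ofReal b)
    (hRg : ∀ i j : ℕ, i + L ≤ j → eLpNorm (P[R j | 𝓖 i]) (ENNReal.ofReal m) P ≤
      ENNReal.ofReal (g * ((j : ℝ) - i) ^ (-α))) :
    eLpNorm (fun ω => ∑ j ∈ Finset.range (2 ^ n), R j ω) (ENNReal.ofReal m) P ≤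
      ENNReal.ofReal (κ * (2 * (L + 1) * b * ((2 : ℝ) ^ n) ^ (1 / 2 : ℝ) +
        D * g * ((2 : ℝ) ^ n) ^ θ)) := by
  classical
  have hp := one_le_ofReal_of_two_le hm
  induction n generalizing 𝓖 R b g with
  | zero =>
    -- A single term is a martingale difference sequence because nothing is required of the mean of
    -- the first term. This yields the factor `κ` without any lower bound on `κ`.
    let 𝓗 : Filtration ℕ mΩ :=
      { seq := fun k => 𝓖 (k + 1)
        mono' := fun a c hac => 𝓖.mono (by gcongr)
        le' := fun k => 𝓖.le _ }
    have h := hκ.eLpNorm_sum_le hm hκ0 (P := P) (𝓖 := 𝓗)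
      (X := fun k => if k = 0 then R 0 else 0) hb ?_ ?_ ?_ 1
    · refine le_trans (le_of_eq ?_) (h.trans (ENNReal.ofReal_le_ofReal ?_))
      · simp
      · have : 0 ≤ D * g := by positivity
        have hL0 : (0 : ℝ) ≤ L := by positivity
        simp only [Nat.cast_one, Real.one_rpow, pow_zero, mul_one]
        gcongr
        nlinarith
    · intro k
      by_cases h : k = 0
      · subst h; simpa using hR 0
      · simpa [h] using stronglyMeasurable_zero
    · intro k
      by_cases h : k = 0
      · subst h; simpa using hRb 0
      · simp [h]
    · intro k; simp
  | succ n ih =>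
    have hmeas : ∀ j, StronglyMeasurable (R j) := fun j => (hR j).mono (𝓖.le _)
    have hint : ∀ j, Integrable (R j) P := fun j =>
      MemLp.integrable hp ⟨(hmeas j).aestronglyMeasurable,
        (hRb j).trans_lt ENNReal.ofReal_lt_top⟩
    -- For `j < L` there is no index `j - L`; `W j = 0` is harmless, as the lag lemma leaves the
    -- first `L` terms unconstrained. The bound `g` on `W j` comes from the decay at lag `L ≥ 1`.
    set W : ℕ → Ω → EuclideanSpace ℝ (Fin d) :=
      fun j => if L ≤ j then P[R j | 𝓖 (j - L)] else 0 with hW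
    have hWm : ∀ j, StronglyMeasurable[𝓖 j] (W j) := by
      intro j
      by_cases h : L ≤ j
      · simpa [hW, h] using stronglyMeasurable_condExp.mono (𝓖.mono (Nat.sub_le j L))
      · simpa [hW, h] using stronglyMeasurable_zero
    have hWi : ∀ j, Integrable (W j) P := by
      intro j
      by_cases h : L ≤ j
      · simpa [hW, h] using integrable_condExp
      · simp [hW, h]
    have hWb : ∀ j, eLpNorm (W j) (ENNReal.ofReal m) P ≤ ENNReal.ofReal b := by
      intro j
      by_cases h : L ≤ j
      · simpa [hW, h] using (eLpNorm_condExp_le_eLpNorm (R j) hp).trans (hRb j)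
      · simp [hW, h]
    have hWg : ∀ j, eLpNorm (W j) (ENNReal.ofReal m) P ≤ ENNReal.ofReal g := by
      intro j
      by_cases h : L ≤ j
      · simp only [hW, h, if_true]
        refine (hRg (j - L) j (by omega)).trans (ENNReal.ofReal_le_ofReal ?_)
        refine mul_le_of_le_one_right hg ?_
        rw [Nat.cast_sub h, sub_sub_cancel]
        exact Real.rpow_le_one_of_one_le_of_nonpos (by exact_mod_cast hL) (by linarith)
      · simp [hW, h]
    have hWcond : ∀ i l : ℕ, i + 2 * L ≤ l → eLpNorm (P[W l | 𝓖 i]) (ENNReal.ofReal m) P ≤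
        ENNReal.ofReal (g * ((l : ℝ) - i) ^ (-α)) := by
      intro i l hil
      have hl : L ≤ l := by omega
      simp only [hW, hl, if_true]
      rw [eLpNorm_congr_ae (condExp_condExp_of_le (𝓖.mono (by omega : i ≤ l - L)) (𝓖.le _))]
      exact hRg i l (by omega)
    have hsplit : (fun ω => ∑ j ∈ Finset.range (2 ^ (n + 1)), R j ω) =
        (fun ω => ∑ j ∈ Finset.range (2 ^ (n + 1)), (R j - W j) ω) +
          fun ω => ∑ j ∈ Finset.range (2 ^ n), (W (j * 2) + W (j * 2 + 1)) ω := by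
      funext ω
      simp only [Pi.add_apply, Pi.sub_apply, Finset.sum_sub_distrib]
      rw [pow_succ, Finset.sum_range_mul_eq (fun j => W j ω)]
      simp [Finset.sum_range_succ]
    have hZ := hκ.eLpNorm_sum_le_of_lag hm hκ0 (P := P) (𝓖 := 𝓖) (Z := fun j => R j - W j)
      (b := 2 * b) (by positivity) L
      (fun j => (hR j).sub ((hWm j).mono (𝓖.mono (Nat.le_succ j))))
      (fun j => by
        refine (eLpNorm_sub_le (hmeas j).aestronglyMeasurable (hWi j).aestronglyMeasurable
          hp).trans ?_
        rw [two_mul, ENNReal.ofReal_add hb hb]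
        exact add_le_add (hRb j) (hWb j))
      (fun j => by
        have : W (j + L) = P[R (j + L) | 𝓖 j] := by simp [hW]
        rw [this]
        exact condExp_sub_condExp_self (𝓖.le j) (hint _)) (2 ^ (n + 1))
    -- Passing to pairs and to every second σ-algebra doubles all distances, so the minimal lag is
    -- again `L`. The decay gains `2 ^ (-α)` from the doubled distance and loses `2` from having two
    -- terms.
    let 𝓗 : Filtration ℕ mΩ :=
      { seq := fun k => 𝓖 (k * 2)
        mono' := fun a c hac => 𝓖.mono (by gcongr)
        le' := fun k => 𝓖.le _ }
    have hW' := ih (𝓖 := 𝓗) (R := fun j => W (j * 2) + W (j * 2 + 1)) (b := 2 * g)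
      (g := 2 ^ (1 - α) * g) (by positivity) (by positivity)
      (fun j => ((hWm _).mono (𝓖.mono (by omega))).add ((hWm _).mono (𝓖.mono (by omega))))
      (fun j => by
        refine (eLpNorm_add_le (hWi _).aestronglyMeasurable (hWi _).aestronglyMeasurable
          hp).trans ?_
        rw [two_mul, ENNReal.ofReal_add hg hg]
        exact add_le_add (hWg _) (hWg _))
      (fun i j hij => by
        change eLpNorm (P[W (j * 2) + W (j * 2 + 1) | 𝓖 (i * 2)]) _ P ≤ _
        rw [eLpNorm_congr_ae (condExp_add (hWi _) (hWi _) _)]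
        refine (eLpNorm_add_le integrable_condExp.aestronglyMeasurable
          integrable_condExp.aestronglyMeasurable hp).trans ?_
        have hij' : (0 : ℝ) < (j : ℝ) - i := by
          have : (i : ℝ) < j := by exact_mod_cast (by omega : i < j)
          linarith
        have hdecay : ∀ l : ℕ, j * 2 ≤ l → eLpNorm (P[W l | 𝓖 (i * 2)]) (ENNReal.ofReal m) P ≤
            ENNReal.ofReal (g * (2 ^ (-α) * ((j : ℝ) - i) ^ (-α))) := by
          intro l hl
          refine (hWcond (i * 2) l (by omega)).trans (ENNReal.ofReal_le_ofReal ?_)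
          rw [← Real.mul_rpow two_pos.le hij'.le]
          have hl' : (j : ℝ) * 2 ≤ l := by exact_mod_cast hl
          refine mul_le_mul_of_nonneg_left ?_ hg
          refine Real.rpow_le_rpow_of_nonpos (by linarith) ?_ (by linarith)
          push_cast
          linarith
        refine (add_le_add (hdecay _ le_rfl) (hdecay _ (Nat.le_succ _))).trans_eq ?_
        rw [← ENNReal.ofReal_add (by positivity) (by positivity)]
        congr 1
        rw [sub_eq_add_neg (1 : ℝ) α, Real.rpow_add two_pos, Real.rpow_one]
        ring)
    rw [hsplit]
    refine (eLpNorm_add_le ?_ ?_ hp).trans ((add_le_add hZ hW').trans ?_)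
    · exact (Finset.stronglyMeasurable_fun_sum _ fun j _ =>
        (hmeas j).sub ((hWm j).mono (𝓖.le j))).aestronglyMeasurable
    · exact (Finset.stronglyMeasurable_fun_sum _ fun j _ =>
        ((hWm _).mono (𝓖.le _)).add ((hWm _).mono (𝓖.le _))).aestronglyMeasurable
    rw [← ENNReal.ofReal_add (by positivity) (by positivity)]
    refine ENNReal.ofReal_le_ofReal ?_
    rw [← mul_add]
    refine mul_le_mul_of_nonneg_left ?_ hκ0
    push_cast
    have h2n : (1 : ℝ) ≤ 2 ^ n := one_le_pow₀ (by norm_num)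
    have hy : ((2 : ℝ) ^ n) ^ (1 / 2 : ℝ) ≤ ((2 : ℝ) ^ n) ^ θ :=
      Real.rpow_le_rpow_of_exponent_le h2n hθ
    have hy0 : 0 ≤ ((2 : ℝ) ^ n) ^ θ := by positivity
    rw [pow_succ (2 : ℝ) n, Real.mul_rpow (y := (2 : ℝ)) (z := θ) (by positivity) (by norm_num)]
    set x := ((2 : ℝ) ^ n) ^ (1 / 2 : ℝ)
    set y := ((2 : ℝ) ^ n) ^ θ
    have hL0 : (0 : ℝ) ≤ (L : ℝ) + 1 := by positivity
    -- The condition on `D` is what closes the recursion: the martingale cost of the next scale,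
    -- where the variables have size `2 g`, fits into `D g` times the gap between `2 ^ θ` and `2 ^
    -- (1 - α)`.
    have h1 : 4 * ((L : ℝ) + 1) * (g * x) ≤ D * (2 ^ θ - 2 ^ (1 - α)) * (g * y) := by
      calc _ ≤ 4 * ((L : ℝ) + 1) * (g * y) := by gcongr
        _ ≤ _ := by gcongr
    nlinarith

end Discrete

/-! ### From discrete lags to time windows -/

/-- The lag, in numbers of windows, from which on the conditional bound is used. -/
noncomputable def windowLag (M : ℝ) : ℕ := ⌈2 * M⌉₊ + 4

/-- The constant in `IsBDGConstant.eLpNorm_sum_window_le`. -/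
noncomputable def windowConst (M α θ : ℝ) : ℝ :=
  max (2 * (windowLag M + 1)) (4 * (windowLag M + 1) / (2 ^ θ - 2 ^ (1 - α)) * 2 ^ α)

theorem windowConst_nonneg (M α θ : ℝ) : 0 ≤ windowConst M α θ :=
  le_max_of_le_left (by positivity)

section Windows

variable {Ω : Type u} {mΩ : MeasurableSpace Ω} {P : Measure Ω} [IsProbabilityMeasure P]
  {d : ℕ} {m κ T : ℝ}

/-- A random variable that is determined by the time interval `[s, e]`, has size `b`, and whose
conditional expectation given `𝓕 t₀` is of size `g (s - t₀) ^ (-α)` if `r ≤ s - t₀`. -/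
structure IsLocalized (P : Measure Ω) (𝓕 : Filtration (Set.Icc (0 : ℝ) T) mΩ)
    (m r α b g : ℝ) (s e : Set.Icc (0 : ℝ) T) (R : Ω → EuclideanSpace ℝ (Fin d)) : Prop where
  measurable : StronglyMeasurable[𝓕 e] R
  bound : eLpNorm R (ENNReal.ofReal m) P ≤ ENNReal.ofReal b
  condBound : ∀ t₀ : Set.Icc (0 : ℝ) T, t₀ < s → r ≤ (s : ℝ) - t₀ →
    eLpNorm (P[R | 𝓕 t₀]) (ENNReal.ofReal m) P ≤ ENNReal.ofReal (g * ((s : ℝ) - t₀) ^ (-α))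

/-- The sum of random variables that are localized in time windows of width `w`. -/
theorem IsBDGConstant.eLpNorm_sum_window_le (hκ : IsBDGConstant.{u} m d κ) (hm : 2 ≤ m)
    (hκ0 : 0 ≤ κ) {𝓕 : Filtration (Set.Icc (0 : ℝ) T) mΩ} (hT : 0 ≤ T) {M α θ : ℝ}
    (hα : 0 ≤ α) (hθ : 1 / 2 ≤ θ) (hαθ : 1 - α < θ) (n : ℕ)
    {R : ℕ → Ω → EuclideanSpace ℝ (Fin d)} {a w b g : ℝ} (ha : 0 ≤ a) (hw : 0 < w) (hb : 0 ≤ b)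
    (hg : 0 ≤ g)
    (hR : ∀ j : ℕ, R j = 0 ∨ ∃ s e : Set.Icc (0 : ℝ) T, a + j * w ≤ s ∧ (e : ℝ) ≤ a + (j + 3) * w ∧
      IsLocalized P 𝓕 m (M * (2 * w)) α b g s e (R j)) :
    eLpNorm (fun ω => ∑ j ∈ Finset.range (2 ^ n), R j ω) (ENNReal.ofReal m) P ≤
      ENNReal.ofReal (windowConst M α θ * (κ * (b * ((2 : ℝ) ^ n) ^ (1 / 2 : ℝ) +
        g * w ^ (-α) * ((2 : ℝ) ^ n) ^ θ))) := by
  set L := windowLag M with hL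
  set D := 4 * ((L : ℝ) + 1) / (2 ^ θ - 2 ^ (1 - α)) with hD
  have hden : 0 < (2 : ℝ) ^ θ - 2 ^ (1 - α) :=
    sub_pos.2 (Real.rpow_lt_rpow_of_exponent_lt (by norm_num) hαθ)
  have hD0 : 0 ≤ D := by positivity
  have hLM : 2 * M + 4 ≤ (L : ℝ) := by
    rw [hL, windowLag]; push_cast
    linarith [Nat.le_ceil (2 * M)]
  have hL4 : 4 ≤ L := by rw [hL, windowLag]; omega
  -- The shift by `2` makes `R j`, which is known at time `a + (j + 3) w`, measurable for `𝓖 (j +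
  -- 1)`. The projection takes care of windows that stick out of `[0, T]`.
  let 𝓖 : Filtration ℕ mΩ :=
    { seq := fun j => 𝓕 (Set.projIcc 0 T hT (a + (j + 2) * w))
      mono' := fun i j hij => 𝓕.mono (Set.monotone_projIcc hT (by gcongr))
      le' := fun k => 𝓕.le _ }
  have hmain := hκ.eLpNorm_sum_two_pow_le (P := P) hm hκ0 (L := L) (by omega) hα hθ hD0
    (by rw [hD, div_mul_cancel₀ _ hden.ne']) n (𝓖 := 𝓖) (R := R) (b := b)
    (g := 2 ^ α * (g * w ^ (-α))) hb (by positivity) ?_ ?_ ?_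
  · refine hmain.trans (ENNReal.ofReal_le_ofReal ?_)
    rw [mul_left_comm (windowConst M α θ)]
    refine mul_le_mul_of_nonneg_left ?_ hκ0
    -- The two entries of the maximum in `windowConst` are the coefficients of `b` and of `g` in the
    -- discrete bound.
    rw [mul_add (windowConst M α θ)]
    refine add_le_add ?_ ?_
    · rw [mul_assoc]
      exact mul_le_mul_of_nonneg_right (le_max_left _ _) (by positivity)
    · rw [← mul_assoc D, mul_assoc (D * 2 ^ α)]
      exact mul_le_mul_of_nonneg_right (le_max_right _ _) (by positivity)
  · intro j
    rcases hR j with h | ⟨s, e, -, he, hloc⟩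
    · rw [h]; exact stronglyMeasurable_zero
    · refine hloc.measurable.mono (𝓕.mono ?_)
      rw [← Set.projIcc_val hT e]
      refine Set.monotone_projIcc hT ?_
      push_cast
      linarith
  · intro j
    rcases hR j with h | ⟨s, e, -, -, hloc⟩
    · simp [h]
    · exact hloc.bound
  · intro i j hij
    rcases hR j with h | ⟨s, e, hs, -, hloc⟩
    · simp [h]
    · have hij' : (i : ℝ) + L ≤ j := by exact_mod_cast hij
      have hL4' : (4 : ℝ) ≤ L := by exact_mod_cast hL4
      have ht : ((Set.projIcc 0 T hT (a + (i + 2) * w) : Set.Icc (0 : ℝ) T) : ℝ) ≤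
          a + (i + 2) * w := by
        rw [Set.coe_projIcc]
        exact max_le (by positivity) (min_le_right _ _)
      have hdist : ((j : ℝ) - i - 2) * w ≤
          (s : ℝ) - (Set.projIcc 0 T hT (a + (i + 2) * w) : Set.Icc (0 : ℝ) T) := by
        nlinarith
      have hpos : 0 < ((j : ℝ) - i - 2) * w := mul_pos (by linarith) hw
      refine (hloc.condBound _ (Subtype.coe_lt_coe.1 (by linarith)) ?_).trans
        (ENNReal.ofReal_le_ofReal ?_)
      · refine le_trans ?_ hdist
        nlinarith
      · have hji : 0 < (j : ℝ) - i := by linarith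
        -- The shift by `2` costs at most half of the distance because the lag is at least `4`; this
        -- is the source of the factor `2 ^ α`. The rest of the lag, `2 M`, ensures that the gap
        -- exceeds `M (2 w)`.
        have h1 : ((j : ℝ) - i) * w * 2⁻¹ ≤ ((j : ℝ) - i - 2) * w := by nlinarith
        calc g * ((s : ℝ) - (Set.projIcc 0 T hT (a + (i + 2) * w) : Set.Icc (0 : ℝ) T)) ^ (-α)
            ≤ g * (((j : ℝ) - i) * w * 2⁻¹) ^ (-α) := by
              refine mul_le_mul_of_nonneg_left ?_ hg
              exact Real.rpow_le_rpow_of_nonpos (by positivity) (h1.trans hdist) (by linarith)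
          _ = _ := by
              rw [Real.mul_rpow (by positivity) (by norm_num), Real.mul_rpow hji.le hw.le,
                Real.inv_rpow (by norm_num), Real.rpow_neg (by norm_num : (0 : ℝ) ≤ 2), inv_inv]
              ring

end Windows

/-! ### Geometric series over dyadic scales -/

theorem dyadic_term_eq {h : ℝ} (hh : 0 ≤ h) (γ θ : ℝ) (k : ℕ) :
    (h * ((2 : ℝ) ^ k)⁻¹) ^ γ * ((2 : ℝ) ^ (k + 1)) ^ θ =
      h ^ γ * 2 ^ θ * ((2 : ℝ) ^ (θ - γ)) ^ k := by
  have h2 : ∀ x : ℝ, ((2 : ℝ) ^ k) ^ x = ((2 : ℝ) ^ x) ^ k := fun x =>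
    (Real.rpow_pow_comm (by norm_num) x k).symm
  rw [Real.mul_rpow hh (by positivity), Real.inv_rpow (by positivity), pow_succ,
    Real.mul_rpow (by positivity) (by norm_num), h2, h2, Real.rpow_sub two_pos, div_pow]
  field_simp

theorem two_rpow_sub_lt_one {γ θ : ℝ} (h : θ < γ) : (2 : ℝ) ^ (θ - γ) < 1 :=
  Real.rpow_lt_one_of_one_lt_of_neg (by norm_num) (by linarith)

/-- At scale `k` there are `2 ^ (k + 1)` cells of length `h 2 ^ (-k)`; the ratio `2 ^ (θ - γ)` is
less than `1`. The exponent `θ = 1` serves the triangle inequality, `θ = 1/2` the martingale part,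
and intermediate scales use `sewingExponent`. -/
theorem hasSum_dyadic {h γ θ : ℝ} (hh : 0 ≤ h) (hγ : θ < γ) :
    HasSum (fun k : ℕ => (h * ((2 : ℝ) ^ k)⁻¹) ^ γ * ((2 : ℝ) ^ (k + 1)) ^ θ)
      (h ^ γ * 2 ^ θ * (1 - (2 : ℝ) ^ (θ - γ))⁻¹) := by
  simp_rw [dyadic_term_eq hh]
  exact (hasSum_geometric_of_lt_one (by positivity) (two_rpow_sub_lt_one hγ)).mul_left _

/-! ### Sums over arbitrary partitions, sorted by dyadic length -/

section Riemann

variable {Ω : Type u} {mΩ : MeasurableSpace Ω} {P : Measure Ω} [IsProbabilityMeasure P]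
  {d : ℕ} {m κ T : ℝ}

theorem PartitionUpTo.abs_sub_le_mesh {τ : Set.Icc (0 : ℝ) T} (π : PartitionUpTo τ) {i : ℕ}
    (hi : i < π.n) : |(π.pt (i + 1) : ℝ) - π.pt i| ≤ π.mesh :=
  le_ciSup (f := fun i : Fin π.n => |(π.pt (i + 1) : ℝ) - π.pt i|)
    (Set.finite_range _).bddAbove ⟨i, hi⟩

theorem PartitionUpTo.pt_le_pt {τ : Set.Icc (0 : ℝ) T} (π : PartitionUpTo τ) {i j : ℕ}
    (hij : i ≤ j) (hj : j ≤ π.n) : π.pt i ≤ π.pt j := by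
  induction j, hij using Nat.le_induction with
  | base => exact le_rfl
  | succ j _ ih => exact (ih (by omega)).trans (π.pt_lt j (by omega)).le

/-- The bound for the sum over intervals of length about `T / 2 ^ l`. -/
noncomputable def classBound (M α θ κ T β₁ β₂ C₁ C₂ C₃ : ℝ) (l : ℕ) : ℝ :=
  windowConst M α θ * (κ *
    (C₂ * ((T * ((2 : ℝ) ^ l)⁻¹) ^ (β₁ - α) * ((2 : ℝ) ^ (l + 1)) ^ (1 / 2 : ℝ)) +
      C₃ * ((T * ((2 : ℝ) ^ l)⁻¹) ^ β₂ * ((2 : ℝ) ^ (l + 1)) ^ (1 / 2 : ℝ)) +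
      C₁ * 2 ^ α * ((T * ((2 : ℝ) ^ l)⁻¹) ^ (β₁ - α) * ((2 : ℝ) ^ (l + 1)) ^ θ)))

theorem summable_classBound {M α θ κ T β₁ β₂ C₁ C₂ C₃ : ℝ} (hT : 0 ≤ T) (hθ : 1 / 2 ≤ θ)
    (hθβ : θ < β₁ - α) (hβ₂ : 1 / 2 < β₂) :
    Summable (classBound M α θ κ T β₁ β₂ C₁ C₂ C₃) := by
  refine Summable.mul_left _ (Summable.mul_left _ (((Summable.mul_left _ ?_).add
    (Summable.mul_left _ ?_)).add (Summable.mul_left _ ?_)))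
  · exact (hasSum_dyadic hT (by linarith)).summable
  · exact (hasSum_dyadic hT hβ₂).summable
  · exact (hasSum_dyadic hT hθβ).summable

/-- If the random variables `R i`, for intervals `[s i, e i]` that follow each other, are
localized with bounds that are powers of the lengths, then the intervals of length about
`T / 2 ^ l` contribute at most `classBound l`. -/
theorem IsBDGConstant.eLpNorm_sum_class_le (hκ : IsBDGConstant.{u} m d κ) (hm : 2 ≤ m)
    (hκ0 : 0 ≤ κ) {𝓕 : Filtration (Set.Icc (0 : ℝ) T) mΩ} (hT : 0 < T) {M α θ β₁ β₂ C₁ C₂ C₃ : ℝ}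
    (hM : 0 ≤ M) (hα : 0 ≤ α) (hθ : 1 / 2 ≤ θ) (hαθ : 1 - α < θ) (hβ₁ : 0 ≤ β₁) (hβα : α ≤ β₁)
    (hβ₂ : 0 ≤ β₂) (hC₁ : 0 ≤ C₁) (hC₂ : 0 ≤ C₂) (hC₃ : 0 ≤ C₃) (l : ℕ) (I : Finset ℕ)
    (t : ℕ → Set.Icc (0 : ℝ) T) (ht : ∀ i ∈ I, ∀ j ∈ I, i < j → t (i + 1) ≤ t j)
    (htl : ∀ i ∈ I, T * ((2 : ℝ) ^ (l + 1))⁻¹ < (t (i + 1) : ℝ) - t i ∧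
      (t (i + 1) : ℝ) - t i ≤ T * ((2 : ℝ) ^ l)⁻¹)
    {R : ℕ → Ω → EuclideanSpace ℝ (Fin d)}
    (hR : ∀ i ∈ I, IsLocalized P 𝓕 m (M * ((t (i + 1) : ℝ) - t i)) α
      (C₂ * ((t (i + 1) : ℝ) - t i) ^ (β₁ - α) + C₃ * ((t (i + 1) : ℝ) - t i) ^ β₂)
      (C₁ * ((t (i + 1) : ℝ) - t i) ^ β₁) (t i) (t (i + 1)) (R i)) :
    eLpNorm (fun ω => ∑ i ∈ I, R i ω) (ENNReal.ofReal m) P ≤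
      ENNReal.ofReal (classBound M α θ κ T β₁ β₂ C₁ C₂ C₃ l) := by
  classical
  set w := T * ((2 : ℝ) ^ (l + 1))⁻¹ with hw
  have hw0 : 0 < w := by positivity
  have hw2 : T * ((2 : ℝ) ^ l)⁻¹ = 2 * w := by
    rw [hw, pow_succ]; field_simp
  have hwT : T = 2 ^ (l + 1) * w := by rw [hw]; field_simp
  -- An interval is assigned to the window of its left endpoint. Its length lies in `(w, 2 w]`: the
  -- lower bound makes the assignment injective, and the upper bound keeps the interval within three
  -- windows.
  let win : ℕ → ℕ := fun i => ⌊(t i : ℝ) / w⌋₊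
  have hwin1 : ∀ i, (win i : ℝ) * w ≤ t i := fun i => by
    rw [← le_div_iff₀ hw0]
    exact Nat.floor_le (div_nonneg (t i).2.1 hw0.le)
  have hwin2 : ∀ i, (t i : ℝ) < (win i + 1) * w := fun i => by
    rw [← div_lt_iff₀ hw0]
    exact Nat.lt_floor_add_one _
  have hmaps : ∀ i ∈ I, win i ∈ Finset.range (2 ^ (l + 1)) := by
    intro i hi
    rw [Finset.mem_range]
    have h1 := (htl i hi).1
    have h2 := (t (i + 1)).2.2
    have h3 : (win i : ℝ) * w < 2 ^ (l + 1) * w := by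
      rw [← hwT]; linarith [hwin1 i]
    exact_mod_cast lt_of_mul_lt_mul_right h3 hw0.le
  have hinj : ∀ i ∈ I, ∀ j ∈ I, i < j → win i ≠ win j := by
    intro i hi j hj hij h
    have h1 := (htl i hi).1
    have h2 : (t (i + 1) : ℝ) ≤ t j := ht i hi j hj hij
    have h3 := hwin1 i
    have h4 := hwin2 j
    rw [← h] at h4
    nlinarith
  have hsum : (fun ω => ∑ i ∈ I, R i ω) = fun ω => ∑ j ∈ Finset.range (2 ^ (l + 1)),
      (∑ i ∈ I with win i = j, R i) ω := by
    funext ω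
    rw [← Finset.sum_fiberwise_of_maps_to hmaps]
    simp
  rw [hsum]
  refine (hκ.eLpNorm_sum_window_le hm hκ0 hT.le (P := P) (𝓕 := 𝓕) (M := M) hα hθ hαθ (l + 1)
    (a := 0) (w := w) (b := C₂ * (2 * w) ^ (β₁ - α) + C₃ * (2 * w) ^ β₂)
    (g := C₁ * (2 * w) ^ β₁) le_rfl hw0 (by positivity) (by positivity) ?_).trans_eq ?_
  · intro j
    rcases (Finset.filter (fun i => win i = j) I).eq_empty_or_nonempty with h | ⟨i, hi⟩
    · left; rw [h, Finset.sum_empty]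
    · right
      obtain ⟨hiI, hij⟩ := Finset.mem_filter.1 hi
      have hsing : Finset.filter (fun i => win i = j) I = {i} := by
        refine Finset.eq_singleton_iff_unique_mem.2 ⟨hi, fun k hk => ?_⟩
        obtain ⟨hkI, hkj⟩ := Finset.mem_filter.1 hk
        rcases lt_trichotomy i k with h | h | h
        · exact absurd (hij.trans hkj.symm) (hinj i hiI k hkI h)
        · exact h.symm
        · exact absurd (hkj.trans hij.symm) (hinj k hkI i hiI h)
      rw [hsing, Finset.sum_singleton]
      obtain ⟨hl1, hl2⟩ := htl i hiI
      rw [hw2] at hl2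
      have hloc := hR i hiI
      have hΔ : 0 ≤ (t (i + 1) : ℝ) - t i := by linarith
      have h1 := hwin1 i
      have h2 := hwin2 i
      rw [hij] at h1 h2
      refine ⟨t i, t (i + 1), by linarith, by nlinarith, hloc.measurable, ?_, ?_⟩
      · refine hloc.bound.trans (ENNReal.ofReal_le_ofReal ?_)
        have := Real.rpow_le_rpow hΔ hl2 (sub_nonneg.2 hβα)
        have := Real.rpow_le_rpow hΔ hl2 hβ₂
        gcongr
      · intro t₀ ht₀ hr
        have ht₀' : 0 ≤ (t i : ℝ) - t₀ := sub_nonneg.2 (Subtype.coe_le_coe.2 ht₀.le)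
        refine (hloc.condBound t₀ ht₀ (le_trans (by gcongr) hr)).trans
          (ENNReal.ofReal_le_ofReal ?_)
        gcongr
  · rw [classBound, hw2]
    -- The window width is half the maximal length of the class, hence the `2 ^ α` in `classBound`.
    have hwα : w ^ (-α) = 2 ^ α * (2 * w) ^ (-α) := by
      rw [Real.mul_rpow two_pos.le hw0.le, ← mul_assoc, ← Real.rpow_add two_pos]
      simp
    rw [hwα, sub_eq_add_neg β₁ α, Real.rpow_add (by positivity : 0 < 2 * w)]
    ring_nf

theorem exists_dyadic_class {x : ℝ} (hT : 0 < T) (hx : 0 < x) (hxT : x ≤ T) :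
    ∃ l : ℕ, T * ((2 : ℝ) ^ (l + 1))⁻¹ < x ∧ x ≤ T * ((2 : ℝ) ^ l)⁻¹ := by
  obtain ⟨l, h1, h2⟩ := exists_nat_pow_near_of_lt_one (x := x / T) (y := (1 / 2 : ℝ))
    (by positivity) (by rwa [div_le_one hT]) (by norm_num) (by norm_num)
  refine ⟨l, ?_, ?_⟩
  · rw [lt_div_iff₀ hT, one_div, inv_pow] at h1; linarith
  · rw [div_le_iff₀ hT, one_div, inv_pow] at h2; linarith

/-- Intervals of very different lengths do not fit one window width, so each dyadic length class is
estimated separately and the classes are combined by the triangle inequality. The mesh excludes all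
classes before `l₀`, which leaves the tail of the series. -/
theorem IsBDGConstant.eLpNorm_sum_partition_le (hκ : IsBDGConstant.{u} m d κ) (hm : 2 ≤ m)
    (hκ0 : 0 ≤ κ) {𝓕 : Filtration (Set.Icc (0 : ℝ) T) mΩ} (hT : 0 < T) {M α θ β₁ β₂ C₁ C₂ C₃ : ℝ}
    (hM : 0 ≤ M) (hα : 0 ≤ α) (hθ : 1 / 2 ≤ θ) (hαθ : 1 - α < θ) (hβ₁ : 0 ≤ β₁) (hβα : α ≤ β₁)
    (hβ₂ : 0 ≤ β₂) (hC₁ : 0 ≤ C₁) (hC₂ : 0 ≤ C₂) (hC₃ : 0 ≤ C₃)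
    {R : Set.Icc (0 : ℝ) T → Set.Icc (0 : ℝ) T → Ω → EuclideanSpace ℝ (Fin d)}
    (hR : ∀ s t : Set.Icc (0 : ℝ) T, s < t → IsLocalized P 𝓕 m (M * ((t : ℝ) - s)) α
      (C₂ * ((t : ℝ) - s) ^ (β₁ - α) + C₃ * ((t : ℝ) - s) ^ β₂)
      (C₁ * ((t : ℝ) - s) ^ β₁) s t (R s t))
    {τ : Set.Icc (0 : ℝ) T} (π : PartitionUpTo τ) (l₀ : ℕ)
    (hl₀ : π.mesh ≤ T * ((2 : ℝ) ^ l₀)⁻¹) :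
    eLpNorm (π.riemannSum R) (ENNReal.ofReal m) P ≤
      ∑' l : ℕ, ENNReal.ofReal (classBound M α θ κ T β₁ β₂ C₁ C₂ C₃ (l + l₀)) := by
  classical
  have hlen : ∀ i, i < π.n → 0 < (π.pt (i + 1) : ℝ) - π.pt i := fun i hi =>
    sub_pos.2 (Subtype.coe_lt_coe.2 (π.pt_lt i hi))
  have hex : ∀ i, ∃ l : ℕ, i < π.n → T * ((2 : ℝ) ^ (l + 1))⁻¹ < (π.pt (i + 1) : ℝ) - π.pt i ∧
      (π.pt (i + 1) : ℝ) - π.pt i ≤ T * ((2 : ℝ) ^ l)⁻¹ := by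
    intro i
    by_cases hi : i < π.n
    · obtain ⟨l, hl⟩ := exists_dyadic_class hT (hlen i hi)
        (by linarith [(π.pt (i + 1)).2.2, (π.pt i).2.1])
      exact ⟨l, fun _ => hl⟩
    · exact ⟨0, fun h => absurd h hi⟩
  choose cls hcls using hex
  have hcls0 : ∀ i, i < π.n → l₀ ≤ cls i := by
    intro i hi
    have h1 := (hcls i hi).1
    have h2 := (le_abs_self _).trans (π.abs_sub_le_mesh hi)
    have h3 : T * ((2 : ℝ) ^ (cls i + 1))⁻¹ < T * ((2 : ℝ) ^ l₀)⁻¹ := by linarith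
    have h4 := (inv_lt_inv₀ (by positivity) (by positivity)).1 (lt_of_mul_lt_mul_left h3 hT.le)
    have h5 := (pow_lt_pow_iff_right₀ (by norm_num : (1 : ℝ) < 2)).1 h4
    omega
  set N := (Finset.range π.n).sup (fun i => cls i - l₀) + 1 with hN
  have hmaps : ∀ i ∈ Finset.range π.n, cls i - l₀ ∈ Finset.range N := by
    intro i hi
    rw [Finset.mem_range, hN, Nat.lt_succ_iff]
    exact Finset.le_sup (f := fun i => cls i - l₀) hi
  have hsum : π.riemannSum R = ∑ l ∈ Finset.range N, fun ω =>
      ∑ i ∈ Finset.range π.n with cls i - l₀ = l, R (π.pt i) (π.pt (i + 1)) ω := by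
    funext ω
    rw [Finset.sum_apply]
    exact (Finset.sum_fiberwise_of_maps_to hmaps _).symm
  have hmeas : ∀ i ∈ Finset.range π.n, StronglyMeasurable (R (π.pt i) (π.pt (i + 1))) := by
    intro i hi
    exact (hR _ _ (π.pt_lt i (Finset.mem_range.1 hi))).measurable.mono (𝓕.le _)
  rw [hsum]
  refine (MeasureTheory.eLpNorm_sum_le (fun l _ => (Finset.stronglyMeasurable_fun_sum _
    fun i hi => hmeas i (Finset.mem_filter.1 hi).1).aestronglyMeasurable)
    (one_le_ofReal_of_two_le hm)).trans ?_
  refine le_trans (Finset.sum_le_sum fun l _ => ?_) (ENNReal.sum_le_tsum (Finset.range N))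
  refine hκ.eLpNorm_sum_class_le hm hκ0 (𝓕 := 𝓕) hT hM hα hθ hαθ hβ₁ hβα hβ₂ hC₁ hC₂ hC₃ (l + l₀) _ π.pt
    ?_ ?_ (R := fun i => R (π.pt i) (π.pt (i + 1))) ?_
  · intro i _ j hj hij
    exact π.pt_le_pt hij (Finset.mem_range.1 (Finset.mem_filter.1 hj).1).le
  · intro i hi
    obtain ⟨h1, h2⟩ := Finset.mem_filter.1 hi
    have h3 := hcls0 i (Finset.mem_range.1 h1)
    have : cls i = l + l₀ := by omega
    rw [← this]
    exact hcls i (Finset.mem_range.1 h1)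
  · intro i hi
    exact hR _ _ (π.pt_lt i (Finset.mem_range.1 (Finset.mem_filter.1 hi).1))

end Riemann

/-! ### Dyadic grids and the algebra of their sums -/

theorem Finset.sum_range_eq_sum_window {M : Type*} [AddCommMonoid M] (f : ℕ → M) (N j₀ J : ℕ)
    (h1 : ∀ j < j₀, f j = 0) (h2 : ∀ j, j₀ + J ≤ j → f j = 0) (h3 : ∀ j, N ≤ j → f j = 0) :
    ∑ j ∈ Finset.range N, f j = ∑ i ∈ Finset.range J, f (j₀ + i) := by
  have hN : ∑ j ∈ Finset.range N, f j = ∑ j ∈ Finset.range (max N (j₀ + J)), f j :=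
    Finset.sum_subset (Finset.range_mono (le_max_left _ _)) fun j _ hj =>
      h3 j (by simpa using hj)
  have hJ : ∑ j ∈ Finset.range (j₀ + J), f j = ∑ j ∈ Finset.range (max N (j₀ + J)), f j :=
    Finset.sum_subset (Finset.range_mono (le_max_right _ _)) fun j _ hj =>
      h2 j (by simpa using hj)
  rw [hN, ← hJ, Finset.sum_range_add, Finset.sum_eq_zero fun j hj => h1 j (Finset.mem_range.1 hj),
    zero_add]

section Grid

variable {T : ℝ}

/-- The projection of a real number to `[s, t]`. -/
noncomputable def clip (s t : Set.Icc (0 : ℝ) T) (x : ℝ) : Set.Icc (0 : ℝ) T :=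
  ⟨max (s : ℝ) (min (t : ℝ) x), le_max_of_le_left s.2.1, max_le s.2.2 ((min_le_left _ _).trans t.2.2)⟩

variable {s t : Set.Icc (0 : ℝ) T} {x y : ℝ}

theorem coe_clip : (clip s t x : ℝ) = max (s : ℝ) (min (t : ℝ) x) := rfl

theorem clip_mono (h : x ≤ y) : clip s t x ≤ clip s t y := by
  rw [← Subtype.coe_le_coe, coe_clip, coe_clip]
  gcongr

theorem clip_of_le (h : x ≤ s) : clip s t x = s :=
  Subtype.ext (by rw [coe_clip]; exact max_eq_left ((min_le_right _ _).trans h))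

theorem clip_of_ge (hst : s ≤ t) (h : (t : ℝ) ≤ x) : clip s t x = t :=
  Subtype.ext (by rw [coe_clip, min_eq_left h]; exact max_eq_right hst)

theorem left_le_clip : s ≤ clip s t x := Subtype.coe_le_coe.1 (le_max_left _ _)

theorem clip_le_right (hst : s ≤ t) : clip s t x ≤ t :=
  Subtype.coe_le_coe.1 (max_le hst (min_le_left _ _))

theorem clip_sub_clip_le (h : x ≤ y) : (clip s t y : ℝ) - clip s t x ≤ y - x := by
  rw [coe_clip, coe_clip]
  rcases max_cases (s : ℝ) (min t y) with h1 | h1 <;>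
  rcases max_cases (s : ℝ) (min t x) with h2 | h2 <;>
  rcases min_cases (t : ℝ) y with h3 | h3 <;>
  rcases min_cases (t : ℝ) x with h4 | h4 <;>
  linarith

variable {Ω E : Type*} [AddCommGroup E]
  {A : Set.Icc (0 : ℝ) T → Set.Icc (0 : ℝ) T → Ω → E}

/-- The Riemann sum along the points of the grid `(T / 2 ^ n) ℤ` that lie in `[s, t]`. -/
noncomputable def gridSum (A : Set.Icc (0 : ℝ) T → Set.Icc (0 : ℝ) T → Ω → E) (s t : Set.Icc (0 : ℝ) T)
    (n : ℕ) : Ω → E :=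
  ∑ j ∈ Finset.range (2 ^ n), A (clip s t (j * (T * ((2 : ℝ) ^ n)⁻¹)))
    (clip s t ((j + 1) * (T * ((2 : ℝ) ^ n)⁻¹)))

/-- The contribution of the cell `[j h, (j + 1) h]` to the difference of two grid sums. -/
noncomputable def cellDelta (A : Set.Icc (0 : ℝ) T → Set.Icc (0 : ℝ) T → Ω → E) (s t : Set.Icc (0 : ℝ) T)
    (h : ℝ) (j : ℕ) : Ω → E :=
  sewDelta A (clip s t (j * h)) (clip s t ((j + 1 / 2) * h)) (clip s t ((j + 1) * h))

theorem sewDelta_eq (a b c : Set.Icc (0 : ℝ) T) : sewDelta A a b c = A a c - A a b - A b c := rfl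

theorem sewDelta_eq_zero (hA : ∀ r, A r r = 0) {a b c : Set.Icc (0 : ℝ) T}
    (h : a = b ∨ b = c) : sewDelta A a b c = 0 := by
  rcases h with rfl | rfl <;> simp [sewDelta_eq, hA]

theorem gridSum_sub_succ (n : ℕ) : gridSum A s t n - gridSum A s t (n + 1) =
    ∑ j ∈ Finset.range (2 ^ n), cellDelta A s t (T * ((2 : ℝ) ^ n)⁻¹) j := by
  have hh : T * ((2 : ℝ) ^ (n + 1))⁻¹ = T * ((2 : ℝ) ^ n)⁻¹ / 2 := by
    rw [pow_succ]; field_simp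
  rw [gridSum, gridSum, pow_succ 2 n, Finset.sum_range_mul_eq, ← Finset.sum_sub_distrib, hh]
  refine Finset.sum_congr rfl fun j _ => ?_
  set h := T * ((2 : ℝ) ^ n)⁻¹
  rw [Finset.sum_range_succ, Finset.sum_range_one, cellDelta, sewDelta_eq]
  have e1 : ((j * 2 + 0 : ℕ) : ℝ) * (h / 2) = j * h := by push_cast; ring
  have e2 : (((j * 2 + 0 : ℕ) : ℝ) + 1) * (h / 2) = (j + 1 / 2) * h := by push_cast; ring
  have e3 : ((j * 2 + 1 : ℕ) : ℝ) * (h / 2) = (j + 1 / 2) * h := by push_cast; ring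
  have e4 : (((j * 2 + 1 : ℕ) : ℝ) + 1) * (h / 2) = (j + 1) * h := by push_cast; ring
  rw [e1, e2, e3, e4]
  abel

theorem le_nat_mul_of_two_pow_le {n j : ℕ} (hT : 0 ≤ T) (hj : 2 ^ n ≤ j) :
    T ≤ j * (T * ((2 : ℝ) ^ n)⁻¹) := by
  have h1 : (2 : ℝ) ^ n ≤ j := by exact_mod_cast hj
  calc T = 2 ^ n * (T * ((2 : ℝ) ^ n)⁻¹) := by field_simp
    _ ≤ _ := by gcongr

/-- If `t - s ≤ h₁ = T / 2 ^ n₁`, then at level `n₁ + k` only `2 ^ (k + 1)` cells contribute. -/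
theorem gridSum_sub_succ_eq_window (hA : ∀ r, A r r = 0) (hT : 0 < T) (hst : s ≤ t) {n₁ : ℕ}
    (hl : (t : ℝ) - s ≤ T * ((2 : ℝ) ^ n₁)⁻¹) (k : ℕ) :
    gridSum A s t (n₁ + k) - gridSum A s t (n₁ + k + 1) =
      ∑ i ∈ Finset.range (2 ^ (k + 1)), cellDelta A s t (T * ((2 : ℝ) ^ (n₁ + k))⁻¹)
        (⌊(s : ℝ) / (T * ((2 : ℝ) ^ (n₁ + k))⁻¹)⌋₊ + i) := by
  rw [gridSum_sub_succ]
  set h := T * ((2 : ℝ) ^ (n₁ + k))⁻¹ with hh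
  have hh0 : 0 < h := by positivity
  set j₀ := ⌊(s : ℝ) / h⌋₊
  have hj1 : (j₀ : ℝ) * h ≤ s := by
    rw [← le_div_iff₀ hh0]; exact Nat.floor_le (div_nonneg s.2.1 hh0.le)
  have hj2 : (s : ℝ) < (j₀ + 1) * h := by
    rw [← div_lt_iff₀ hh0]; exact Nat.lt_floor_add_one _
  have hright : ∀ j : ℕ, (t : ℝ) ≤ j * h → cellDelta A s t h j = 0 := by
    intro j hj
    refine sewDelta_eq_zero hA (Or.inl ?_)
    rw [clip_of_ge hst hj, clip_of_ge hst (by nlinarith)]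
  refine Finset.sum_range_eq_sum_window _ _ _ _ (fun j hj => ?_) (fun j hj => ?_) fun j hj => ?_
  · have hj' : (j : ℝ) + 1 ≤ j₀ := by exact_mod_cast hj
    refine sewDelta_eq_zero hA (Or.inr ?_)
    rw [clip_of_le (by nlinarith), clip_of_le (by nlinarith)]
  · refine hright j ?_
    have hj' : (j₀ : ℝ) + 2 ^ (k + 1) ≤ j := by exact_mod_cast hj
    -- The interval covers at most `2 ^ k` cell lengths, but starts somewhere inside cell `j₀`. One
    -- further cell is needed, and `2 ^ (k + 1)` leaves room for it.
    have h1 : T * ((2 : ℝ) ^ n₁)⁻¹ = 2 ^ k * h := by rw [hh, pow_add]; field_simp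
    have h2 : (1 : ℝ) ≤ 2 ^ k := one_le_pow₀ (by norm_num)
    rw [pow_succ] at hj'
    rw [h1] at hl
    nlinarith
  · exact hright j (t.2.2.trans (le_nat_mul_of_two_pow_le hT.le hj))

/-- If `t - s ≤ T / 2 ^ n`, then the grid of level `n` has essentially one point in `[s, t]`. -/
theorem exists_sub_gridSum_eq (hA : ∀ r, A r r = 0) (hT : 0 < T) (hst : s ≤ t) {n : ℕ}
    (hl : (t : ℝ) - s ≤ T * ((2 : ℝ) ^ n)⁻¹) :
    ∃ p, s ≤ p ∧ p ≤ t ∧ A s t - gridSum A s t n = sewDelta A s p t := by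
  set h := T * ((2 : ℝ) ^ n)⁻¹ with hh
  have hh0 : 0 < h := by positivity
  set j₀ := ⌊(s : ℝ) / h⌋₊
  have hj1 : (j₀ : ℝ) * h ≤ s := by
    rw [← le_div_iff₀ hh0]; exact Nat.floor_le (div_nonneg s.2.1 hh0.le)
  have hj2 : (s : ℝ) < (j₀ + 1) * h := by
    rw [← div_lt_iff₀ hh0]; exact Nat.lt_floor_add_one _
  refine ⟨clip s t ((j₀ + 1) * h), left_le_clip, clip_le_right hst, ?_⟩
  have hright : ∀ j : ℕ, (t : ℝ) ≤ j * h →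
      A (clip s t (j * h)) (clip s t ((j + 1) * h)) = 0 := by
    intro j hj
    rw [clip_of_ge hst hj, clip_of_ge hst (by nlinarith), hA]
  rw [gridSum, ← hh, Finset.sum_range_eq_sum_window _ (2 ^ n) j₀ 2 (fun j hj => ?_)
    (fun j hj => ?_) fun j hj => ?_]
  · have e1 : clip s t (((j₀ + 0 : ℕ) : ℝ) * h) = s := clip_of_le (by push_cast; linarith)
    have e2 : clip s t ((((j₀ + 1 : ℕ) : ℝ) + 1) * h) = t :=
      clip_of_ge hst (by push_cast; nlinarith)
    rw [Finset.sum_range_succ, Finset.sum_range_one, e1, e2, sewDelta_eq]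
    push_cast
    rw [add_zero]
    abel
  · have hj' : (j : ℝ) + 1 ≤ j₀ := by exact_mod_cast hj
    rw [clip_of_le (by nlinarith), clip_of_le (by nlinarith), hA]
  · have hj' : (j₀ : ℝ) + 2 ≤ j := by exact_mod_cast hj
    exact hright j (by nlinarith)
  · exact hright j (t.2.2.trans (le_nat_mul_of_two_pow_le hT.le hj))

/-- The grid sums are additive up to the contribution of a single cell. -/
theorem exists_gridSum_sub_sub_eq (hA : ∀ r, A r r = 0) (hT : 0 < T) (hst : s < t)
    {z : Set.Icc (0 : ℝ) T} (hz : (z : ℝ) = 0) (n : ℕ) :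
    ∃ a c, a ≤ s ∧ s < c ∧ (c : ℝ) - a ≤ T * ((2 : ℝ) ^ n)⁻¹ ∧
      gridSum A z t n - gridSum A z s n - gridSum A s t n = sewDelta A a s c := by
  set h := T * ((2 : ℝ) ^ n)⁻¹ with hh
  have hh0 : 0 < h := by positivity
  set j₀ := ⌊(s : ℝ) / h⌋₊
  have hj1 : (j₀ : ℝ) * h ≤ s := by
    rw [← le_div_iff₀ hh0]; exact Nat.floor_le (div_nonneg s.2.1 hh0.le)
  have hj2 : (s : ℝ) < (j₀ + 1) * h := by
    rw [← div_lt_iff₀ hh0]; exact Nat.lt_floor_add_one _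
  have hzt : z ≤ t := by rw [← Subtype.coe_le_coe, hz]; exact t.2.1
  have hzs : z ≤ s := by rw [← Subtype.coe_le_coe, hz]; exact s.2.1
  have hst' : (s : ℝ) < t := hst
  -- The grid is the same for all intervals, so cells left of `s` cancel between `[0, t]` and `[0,
  -- s]`, and cells right of `s` between `[0, t]` and `[s, t]`. Only the cell straddling `s`
  -- survives.
  have hleft : ∀ x : ℝ, x ≤ s → clip z t x = clip z s x := fun x hx => by
    refine Subtype.ext ?_
    rw [coe_clip, coe_clip, min_eq_right hx, min_eq_right (hx.trans hst'.le)]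
  have hrt : ∀ x : ℝ, (s : ℝ) ≤ x → clip z t x = clip s t x := fun x hx => by
    refine Subtype.ext ?_
    rw [coe_clip, coe_clip, max_eq_right (le_min hst'.le hx), hz,
      max_eq_right (le_min t.2.1 (s.2.1.trans hx))]
  have hright : ∀ j : ℕ, (s : ℝ) ≤ j * h →
      A (clip z t (j * h)) (clip z t ((j + 1) * h)) -
      A (clip z s (j * h)) (clip z s ((j + 1) * h)) -
      A (clip s t (j * h)) (clip s t ((j + 1) * h)) = 0 := by
    intro j hj
    have hj' : (s : ℝ) ≤ (j + 1) * h := by nlinarith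
    rw [hrt _ hj, hrt _ hj', clip_of_ge hzs hj, clip_of_ge hzs hj', hA]
    abel
  refine ⟨clip z t (j₀ * h), clip z t ((j₀ + 1) * h), ?_, ?_, ?_, ?_⟩
  · rw [hleft _ hj1]; exact clip_le_right hzs
  · rw [← Subtype.coe_lt_coe, coe_clip]
    exact lt_max_of_lt_right (lt_min hst' hj2)
  · refine (clip_sub_clip_le (by nlinarith)).trans (by linarith)
  · rw [gridSum, gridSum, gridSum, ← hh, ← Finset.sum_sub_distrib, ← Finset.sum_sub_distrib,
      Finset.sum_range_eq_sum_window _ (2 ^ n) j₀ 1 (fun j hj => ?_) (fun j hj => ?_) fun j hj => ?_]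
    · rw [Finset.sum_range_one, add_zero, hrt _ hj2.le, hleft _ hj1, clip_of_ge hzs hj2.le,
        clip_of_le hj1, sewDelta_eq]
    · have hj' : (j : ℝ) + 1 ≤ j₀ := by exact_mod_cast hj
      have h1 : ((j : ℝ) + 1) * h ≤ s := by nlinarith
      have h2 : (j : ℝ) * h ≤ s := by nlinarith
      rw [hleft _ h1, hleft _ h2, clip_of_le h1, clip_of_le h2, hA]
      abel
    · have hj' : (j₀ : ℝ) + 1 ≤ j := by exact_mod_cast hj
      exact hright j (by nlinarith)
    · exact hright j (s.2.2.trans (le_nat_mul_of_two_pow_le hT.le hj))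

end Grid

/-! ### Estimates for one refinement of the grid -/

section Germ

variable {Ω : Type u} {mΩ : MeasurableSpace Ω} {P : Measure Ω} [IsProbabilityMeasure P]
  {d : ℕ} {m κ T : ℝ} {𝓕 : Filtration (Set.Icc (0 : ℝ) T) mΩ}
  {A : Set.Icc (0 : ℝ) T → Set.Icc (0 : ℝ) T → Ω → EuclideanSpace ℝ (Fin d)}
  {Γ₁ Γ₂ M α β₁ β₂ θ : ℝ} {s t : Set.Icc (0 : ℝ) T}

/-- The hypotheses of the stochastic sewing lemma, for a germ that vanishes on the diagonal. -/
structure IsSewingGerm (P : Measure Ω) (𝓕 : Filtration (Set.Icc (0 : ℝ) T) mΩ)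
    (A : Set.Icc (0 : ℝ) T → Set.Icc (0 : ℝ) T → Ω → EuclideanSpace ℝ (Fin d))
    (m Γ₁ Γ₂ M α β₁ β₂ : ℝ) : Prop where
  diag : ∀ s, A s s = 0
  adapted : ∀ s t, s ≤ t → StronglyMeasurable[𝓕 t] (A s t)
  memLp : ∀ s t, s ≤ t → MemLp (A s t) (ENNReal.ofReal m) P
  condBound : ∀ t₀ t₁ t₂ t₃ : Set.Icc (0 : ℝ) T, t₀ < t₁ → t₁ < t₂ → t₂ < t₃ →
    M * ((t₃ : ℝ) - t₁) ≤ (t₁ : ℝ) - t₀ →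
    eLpNorm (P[sewDelta A t₁ t₂ t₃ | 𝓕 t₀]) (ENNReal.ofReal m) P ≤
      ENNReal.ofReal (Γ₁ * ((t₁ : ℝ) - t₀) ^ (-α) * ((t₃ : ℝ) - t₁) ^ β₁)
  bound : ∀ t₀ t₁ t₂ : Set.Icc (0 : ℝ) T, t₀ < t₁ → t₁ < t₂ →
    eLpNorm (sewDelta A t₀ t₁ t₂) (ENNReal.ofReal m) P ≤
      ENNReal.ofReal (Γ₂ * ((t₂ : ℝ) - t₀) ^ β₂)

theorem eLpNorm_sum_le_of_hasSum (hm : 2 ≤ m) {f : ℕ → Ω → EuclideanSpace ℝ (Fin d)} {B : ℕ → ℝ}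
    {S : ℝ} (hf : ∀ k, AEStronglyMeasurable (f k) P)
    (hfB : ∀ k, eLpNorm (f k) (ENNReal.ofReal m) P ≤ ENNReal.ofReal (B k)) (hB0 : ∀ k, 0 ≤ B k)
    (hB : HasSum B S) (N : ℕ) :
    eLpNorm (∑ k ∈ Finset.range N, f k) (ENNReal.ofReal m) P ≤ ENNReal.ofReal S := by
  refine (MeasureTheory.eLpNorm_sum_le (fun k _ => hf k) (one_le_ofReal_of_two_le hm)).trans ?_
  refine (Finset.sum_le_sum fun k _ => hfB k).trans ?_
  rw [← ENNReal.ofReal_sum_of_nonneg fun k _ => hB0 k]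
  exact ENNReal.ofReal_le_ofReal (sum_le_hasSum _ (fun k _ => hB0 k) hB)

theorem IsLocalized.mono {r r' b b' g g' : ℝ} {e : Set.Icc (0 : ℝ) T}
    {R : Ω → EuclideanSpace ℝ (Fin d)} (h : IsLocalized P 𝓕 m r α b g s e R) (hr : r ≤ r')
    (hb : b ≤ b') (hg : g ≤ g') : IsLocalized P 𝓕 m r' α b' g' s e R where
  measurable := h.measurable
  bound := h.bound.trans (ENNReal.ofReal_le_ofReal hb)
  condBound t₀ ht₀ hr' := by
    have : 0 ≤ (s : ℝ) - t₀ := sub_nonneg.2 (Subtype.coe_le_coe.2 ht₀.le)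
    refine (h.condBound t₀ ht₀ (hr.trans hr')).trans (ENNReal.ofReal_le_ofReal ?_)
    gcongr

namespace IsSewingGerm

theorem adapted_sewDelta (hA : IsSewingGerm P 𝓕 A m Γ₁ Γ₂ M α β₁ β₂)
    {a b c : Set.Icc (0 : ℝ) T} (hab : a ≤ b) (hbc : b ≤ c) :
    StronglyMeasurable[𝓕 c] (sewDelta A a b c) :=
  ((hA.adapted a c (hab.trans hbc)).sub ((hA.adapted a b hab).mono (𝓕.mono hbc))).sub
    (hA.adapted b c hbc)

theorem isLocalized (hA : IsSewingGerm P 𝓕 A m Γ₁ Γ₂ M α β₁ β₂) {a b c : Set.Icc (0 : ℝ) T}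
    (hab : a < b) (hbc : b < c) :
    IsLocalized P 𝓕 m (M * ((c : ℝ) - a)) α (Γ₂ * ((c : ℝ) - a) ^ β₂)
      (Γ₁ * ((c : ℝ) - a) ^ β₁) a c (sewDelta A a b c) where
  measurable := hA.adapted_sewDelta hab.le hbc.le
  bound := hA.bound a b c hab hbc
  condBound t₀ ht₀ hr := by
    rw [mul_right_comm]
    exact hA.condBound t₀ a b c ht₀ hab hbc hr

/-- Clipping a cell to `[s, t]` either leaves three distinct points or merges two neighbours, and
`δA` vanishes in the latter case because `A` vanishes on the diagonal. The hypotheses on `δA`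
concern distinct points only. -/
theorem cellDelta_eq (hA : IsSewingGerm P 𝓕 A m Γ₁ Γ₂ M α β₁ β₂) (hst : s ≤ t) {h : ℝ}
    (hh : 0 < h) (j : ℕ) : cellDelta A s t h j = 0 ∨ ∃ a b c : Set.Icc (0 : ℝ) T,
      cellDelta A s t h j = sewDelta A a b c ∧ a < b ∧ b < c ∧ s ≤ a ∧ c ≤ t ∧
      (j : ℝ) * h ≤ a ∧ (c : ℝ) ≤ max (s : ℝ) ((j + 1) * h) ∧ (c : ℝ) - a ≤ h := by
  have h1 : (j : ℝ) * h ≤ (j + 1 / 2) * h := by gcongr; linarith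
  have h2 : ((j : ℝ) + 1 / 2) * h ≤ (j + 1) * h := by gcongr; linarith
  rcases (clip_mono (s := s) (t := t) h1).eq_or_lt with h3 | h3
  · exact Or.inl (sewDelta_eq_zero hA.diag (Or.inl h3))
  rcases (clip_mono (s := s) (t := t) h2).eq_or_lt with h4 | h4
  · exact Or.inl (sewDelta_eq_zero hA.diag (Or.inr h4))
  refine Or.inr ⟨_, _, _, rfl, h3, h4, left_le_clip, clip_le_right hst, ?_, ?_, ?_⟩
  · by_contra hcon
    rw [coe_clip, not_le] at hcon
    have h5 : (t : ℝ) ≤ j * h := by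
      by_contra hlt
      rw [min_eq_right (not_le.1 hlt).le] at hcon
      exact absurd (le_max_right _ _) (not_le.2 hcon)
    rw [clip_of_ge hst h5, clip_of_ge hst (h5.trans h1)] at h3
    exact lt_irrefl _ h3
  · rw [coe_clip]
    exact max_le_max le_rfl (min_le_right _ _)
  · refine (clip_sub_clip_le (h1.trans h2)).trans (by linarith)

/-- The gap condition for `[s, t]` passes to every subinterval `[a, c]`: the distance to `t₀` grows
and the length shrinks. As `α ≥ 0`, the singular factor may be frozen at `s - t₀`. -/
theorem eLpNorm_condExp_sewDelta_le (hA : IsSewingGerm P 𝓕 A m Γ₁ Γ₂ M α β₁ β₂) (hΓ₁ : 0 ≤ Γ₁)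
    (hM : 0 ≤ M) (hα : 0 ≤ α) (hβ₁ : 0 ≤ β₁) {t₀ a b c : Set.Icc (0 : ℝ) T} (ht₀ : t₀ < s)
    (hr : M * ((t : ℝ) - s) ≤ (s : ℝ) - t₀) (hsa : s ≤ a) (hab : a ≤ b) (hbc : b ≤ c)
    (hct : c ≤ t) {h : ℝ} (hh : (c : ℝ) - a ≤ h) :
    eLpNorm (P[sewDelta A a b c | 𝓕 t₀]) (ENNReal.ofReal m) P ≤
      ENNReal.ofReal (Γ₁ * ((s : ℝ) - t₀) ^ (-α) * h ^ β₁) := by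
  rcases hab.eq_or_lt with h3 | h3
  · simp [sewDelta_eq_zero hA.diag (Or.inl h3)]
  rcases hbc.eq_or_lt with h4 | h4
  · simp [sewDelta_eq_zero hA.diag (Or.inr h4)]
  have hsa' : (s : ℝ) ≤ a := hsa
  have hct' : (c : ℝ) ≤ t := hct
  have hac : (a : ℝ) < c := h3.trans h4
  have hs0 : (t₀ : ℝ) < s := ht₀
  have h5 : M * ((c : ℝ) - a) ≤ M * ((t : ℝ) - s) := by gcongr
  refine (hA.condBound t₀ a b c (ht₀.trans_le hsa) h3 h4 (by linarith)).trans
    (ENNReal.ofReal_le_ofReal ?_)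
  have h6 : ((a : ℝ) - t₀) ^ (-α) ≤ ((s : ℝ) - t₀) ^ (-α) :=
    Real.rpow_le_rpow_of_nonpos (by linarith) (by linarith) (by linarith)
  have h7 : ((c : ℝ) - a) ^ β₁ ≤ h ^ β₁ := Real.rpow_le_rpow (by linarith) hh hβ₁
  have h8 : 0 ≤ ((c : ℝ) - a) ^ β₁ := Real.rpow_nonneg (by linarith) _
  have h9 : 0 ≤ ((s : ℝ) - t₀) ^ (-α) := Real.rpow_nonneg (by linarith) _
  gcongr

theorem memLp_sewDelta (hA : IsSewingGerm P 𝓕 A m Γ₁ Γ₂ M α β₁ β₂)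
    {a b c : Set.Icc (0 : ℝ) T} (hab : a ≤ b) (hbc : b ≤ c) :
    MemLp (sewDelta A a b c) (ENNReal.ofReal m) P :=
  ((hA.memLp a c (hab.trans hbc)).sub (hA.memLp a b hab)).sub (hA.memLp b c hbc)

theorem adapted_gridSum (hA : IsSewingGerm P 𝓕 A m Γ₁ Γ₂ M α β₁ β₂) (hT : 0 ≤ T) (hst : s ≤ t)
    (n : ℕ) : StronglyMeasurable[𝓕 t] (gridSum A s t n) := by
  refine Finset.stronglyMeasurable_sum _ fun j _ => ?_
  exact (hA.adapted _ _ (clip_mono (by gcongr; linarith))).mono (𝓕.mono (clip_le_right hst))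

theorem memLp_gridSum (hA : IsSewingGerm P 𝓕 A m Γ₁ Γ₂ M α β₁ β₂) (hT : 0 ≤ T) (n : ℕ) :
    MemLp (gridSum A s t n) (ENNReal.ofReal m) P :=
  memLp_finsetSum' _ fun j _ => hA.memLp _ _ (clip_mono (by gcongr; linarith))

/-- The `L_m` size of the difference of consecutive grid sums. -/
theorem eLpNorm_gridSum_sub_succ_le (hA : IsSewingGerm P 𝓕 A m Γ₁ Γ₂ M α β₁ β₂)
    (hκ : IsBDGConstant.{u} m d κ) (hm : 2 ≤ m) (hκ0 : 0 ≤ κ) (hΓ₁ : 0 ≤ Γ₁) (hΓ₂ : 0 ≤ Γ₂)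
    (hM : 0 ≤ M) (hα : 0 ≤ α) (hβ₁ : 0 ≤ β₁) (hβ₂ : 0 ≤ β₂) (hθ : 1 / 2 ≤ θ) (hαθ : 1 - α < θ)
    (hT : 0 < T) (hst : s ≤ t) {n₁ : ℕ} (hl : (t : ℝ) - s ≤ T * ((2 : ℝ) ^ n₁)⁻¹) (k : ℕ) :
    eLpNorm (gridSum A s t (n₁ + k) - gridSum A s t (n₁ + k + 1)) (ENNReal.ofReal m) P ≤
      ENNReal.ofReal (windowConst M α θ * (κ *
        (Γ₂ * ((T * ((2 : ℝ) ^ n₁)⁻¹ * ((2 : ℝ) ^ k)⁻¹) ^ β₂ *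
          ((2 : ℝ) ^ (k + 1)) ^ (1 / 2 : ℝ)) +
        Γ₁ * ((T * ((2 : ℝ) ^ n₁)⁻¹ * ((2 : ℝ) ^ k)⁻¹) ^ (β₁ - α) *
          ((2 : ℝ) ^ (k + 1)) ^ θ)))) := by
  have hh : T * ((2 : ℝ) ^ n₁)⁻¹ * ((2 : ℝ) ^ k)⁻¹ = T * ((2 : ℝ) ^ (n₁ + k))⁻¹ := by
    rw [pow_add, mul_inv, mul_assoc]
  rw [gridSum_sub_succ_eq_window hA.diag hT hst hl, hh]
  set h := T * ((2 : ℝ) ^ (n₁ + k))⁻¹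
  have hh0 : 0 < h := by positivity
  set j₀ := ⌊(s : ℝ) / h⌋₊
  have hj2 : (s : ℝ) < (j₀ + 1) * h := by
    rw [← div_lt_iff₀ hh0]; exact Nat.lt_floor_add_one _
  have hw := hκ.eLpNorm_sum_window_le hm hκ0 hT.le (P := P) (𝓕 := 𝓕) (M := M) hα hθ hαθ (k + 1)
    (R := fun i => cellDelta A s t h (j₀ + i)) (a := j₀ * h) (w := h) (b := Γ₂ * h ^ β₂)
    (g := Γ₁ * h ^ β₁) (by positivity) hh0 (by positivity) (by positivity) ?_
  · have e : (∑ i ∈ Finset.range (2 ^ (k + 1)), cellDelta A s t h (j₀ + i)) =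
        fun ω => ∑ i ∈ Finset.range (2 ^ (k + 1)), cellDelta A s t h (j₀ + i) ω := by
      funext ω; simp
    rw [e]
    refine hw.trans_eq ?_
    rw [sub_eq_add_neg β₁ α, Real.rpow_add hh0]
    ring_nf
  · intro i
    refine (hA.cellDelta_eq hst hh0 (j₀ + i)).imp id ?_
    rintro ⟨a, b, c, he, hab, hbc, -, -, ha, hc, hca⟩
    have hac : 0 ≤ (c : ℝ) - a := sub_nonneg.2 (Subtype.coe_le_coe.2 (hab.trans hbc).le)
    push_cast at ha hc
    refine ⟨a, c, by linarith, hc.trans (max_le ?_ ?_), ?_⟩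
    · have : 0 ≤ (i : ℝ) * h := by positivity
      linarith
    · linarith
    · rw [he]
      refine (hA.isLocalized hab hbc).mono ?_ ?_ ?_
      · gcongr; linarith
      · gcongr
      · gcongr

/-- The conditional size of the difference of consecutive grid sums. -/
theorem eLpNorm_condExp_gridSum_sub_succ_le (hA : IsSewingGerm P 𝓕 A m Γ₁ Γ₂ M α β₁ β₂)
    (hm : 2 ≤ m) (hΓ₁ : 0 ≤ Γ₁) (hM : 0 ≤ M) (hα : 0 ≤ α) (hβ₁ : 0 ≤ β₁) (hT : 0 < T)
    (hst : s ≤ t) {n₁ : ℕ} (hl : (t : ℝ) - s ≤ T * ((2 : ℝ) ^ n₁)⁻¹) {t₀ : Set.Icc (0 : ℝ) T}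
    (ht₀ : t₀ < s) (hr : M * ((t : ℝ) - s) ≤ (s : ℝ) - t₀) (k : ℕ) :
    eLpNorm (P[gridSum A s t (n₁ + k) - gridSum A s t (n₁ + k + 1) | 𝓕 t₀])
        (ENNReal.ofReal m) P ≤
      ENNReal.ofReal (Γ₁ * ((s : ℝ) - t₀) ^ (-α) *
        ((T * ((2 : ℝ) ^ n₁)⁻¹ * ((2 : ℝ) ^ k)⁻¹) ^ β₁ * ((2 : ℝ) ^ (k + 1)) ^ (1 : ℝ))) := by
  have hh : T * ((2 : ℝ) ^ n₁)⁻¹ * ((2 : ℝ) ^ k)⁻¹ = T * ((2 : ℝ) ^ (n₁ + k))⁻¹ := by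
    rw [pow_add, mul_inv, mul_assoc]
  have hp := one_le_ofReal_of_two_le hm
  rw [gridSum_sub_succ_eq_window hA.diag hT hst hl, hh]
  set h := T * ((2 : ℝ) ^ (n₁ + k))⁻¹
  have hh0 : 0 < h := by positivity
  have hcell : ∀ j, MemLp (cellDelta A s t h j) (ENNReal.ofReal m) P := fun j =>
    hA.memLp_sewDelta (clip_mono (by gcongr; linarith)) (clip_mono (by gcongr; linarith))
  -- The triangle inequality over `2 ^ (k + 1)` cells suffices here, without cancellation, since `β₁
  -- > 1` will make the series over `k` converge.
  rw [eLpNorm_congr_ae (condExp_finsetSum (fun i _ => (hcell _).integrable hp) _)]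
  refine (MeasureTheory.eLpNorm_sum_le (fun i _ => integrable_condExp.aestronglyMeasurable)
    hp).trans ?_
  have hterm : ∀ j, eLpNorm (P[cellDelta A s t h j | 𝓕 t₀]) (ENNReal.ofReal m) P ≤
      ENNReal.ofReal (Γ₁ * ((s : ℝ) - t₀) ^ (-α) * h ^ β₁) := fun j => by
    rw [cellDelta]
    exact hA.eLpNorm_condExp_sewDelta_le hΓ₁ hM hα hβ₁ ht₀ hr left_le_clip
      (clip_mono (by gcongr; linarith)) (clip_mono (by gcongr; linarith)) (clip_le_right hst)
      ((clip_sub_clip_le (by gcongr; linarith)).trans (by linarith))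
  refine (Finset.sum_le_sum fun i _ => hterm _).trans_eq ?_
  rw [Finset.sum_const, Finset.card_range, nsmul_eq_mul, ← ENNReal.ofReal_natCast,
    ← ENNReal.ofReal_mul (by positivity), Real.rpow_one]
  congr 1
  push_cast
  ring

/-- A single `δA` in the form of the other bounds. -/
theorem eLpNorm_sewDelta_le (hA : IsSewingGerm P 𝓕 A m Γ₁ Γ₂ M α β₁ β₂)
    (hκ : IsBDGConstant.{u} m d κ) (hm : 2 ≤ m) (hκ0 : 0 ≤ κ) (hΓ₁ : 0 ≤ Γ₁) (hΓ₂ : 0 ≤ Γ₂)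
    (hM : 0 ≤ M) (hα : 0 ≤ α) (hθ : 1 / 2 ≤ θ) (hαθ : 1 - α < θ) (hst : s < t)
    {p : Set.Icc (0 : ℝ) T} (hsp : s ≤ p) (hpt : p ≤ t) :
    eLpNorm (sewDelta A s p t) (ENNReal.ofReal m) P ≤
      ENNReal.ofReal (windowConst M α θ * (κ *
        (Γ₂ * ((t : ℝ) - s) ^ β₂ + Γ₁ * ((t : ℝ) - s) ^ (β₁ - α)))) := by
  rcases hsp.eq_or_lt with h3 | h3
  · simp [sewDelta_eq_zero hA.diag (Or.inl h3)]
  rcases hpt.eq_or_lt with h4 | h4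
  · simp [sewDelta_eq_zero hA.diag (Or.inr h4)]
  have hl : 0 < (t : ℝ) - s := sub_pos.2 hst
  -- The bound in the hypothesis carries no `κ`. Viewing `δA` as a sum with one window inserts this
  -- factor without a lower bound on `κ`; for `d = 0` the best constant is `0`.
  have hw := hκ.eLpNorm_sum_window_le hm hκ0 (s.2.1.trans s.2.2) (P := P) (𝓕 := 𝓕) (M := M) hα hθ
    hαθ 0 (R := fun i => if i = 0 then sewDelta A s p t else 0) (a := s) (w := (t : ℝ) - s)
    (b := Γ₂ * ((t : ℝ) - s) ^ β₂) (g := Γ₁ * ((t : ℝ) - s) ^ β₁) s.2.1 hl (by positivity)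
    (by positivity) ?_
  · simp only [pow_zero, Finset.sum_range_one, if_true, Real.one_rpow, mul_one] at hw
    refine hw.trans_eq ?_
    rw [sub_eq_add_neg β₁ α, Real.rpow_add hl]
    ring_nf
  · intro i
    by_cases hi : i = 0
    · subst hi
      refine Or.inr ⟨s, t, by simp, by push_cast; linarith, ?_⟩
      simp only [if_true]
      exact (hA.isLocalized h3 h4).mono (by gcongr; linarith) le_rfl le_rfl
    · exact Or.inl (by simp [hi])

theorem sub_gridSum_eq (n₁ N : ℕ) : A s t - gridSum A s t (n₁ + N) =
    (A s t - gridSum A s t n₁) +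
      ∑ k ∈ Finset.range N, (gridSum A s t (n₁ + k) - gridSum A s t (n₁ + k + 1)) := by
  have h := Finset.sum_range_sub' (fun k => gridSum A s t (n₁ + k)) N
  simp only [← add_assoc, add_zero] at h
  rw [h]
  abel

end IsSewingGerm

end Germ

/-! ### Constants, completeness, and summation over the scales -/

/-- The exponent `θ` with `max (1/2) (1 - α) < θ < β₁ - α`. -/
noncomputable def sewingExponent (α β₁ : ℝ) : ℝ := (max (1 / 2) (1 - α) + (β₁ - α)) / 2

/-- The constant of the conditional bound. -/
noncomputable def sewingConst₁ (β₁ : ℝ) : ℝ := 1 + 2 ^ β₁ * (2 * (1 - (2 : ℝ) ^ (1 - β₁))⁻¹)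

/-- The constant of the term with exponent `β₁ - α`. -/
noncomputable def sewingConst₂ (α β₁ _β₂ M : ℝ) : ℝ :=
  windowConst M α (sewingExponent α β₁) * (1 + 2 ^ (β₁ - α) * (2 ^ sewingExponent α β₁ *
    (1 - (2 : ℝ) ^ (sewingExponent α β₁ - (β₁ - α)))⁻¹))

/-- The constant of the term with exponent `β₂`. -/
noncomputable def sewingConst₃ (α β₁ β₂ M : ℝ) : ℝ :=
  windowConst M α (sewingExponent α β₁) * (1 + 2 ^ β₂ * (2 ^ (1 / 2 : ℝ) *
    (1 - (2 : ℝ) ^ (1 / 2 - β₂))⁻¹))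

theorem inv_one_sub_two_rpow_nonneg {γ θ : ℝ} (h : θ < γ) : 0 ≤ (1 - (2 : ℝ) ^ (θ - γ))⁻¹ :=
  inv_nonneg.2 (sub_nonneg.2 (two_rpow_sub_lt_one h).le)

theorem dyadic_sum_le {h l γ θ : ℝ} (hh : 0 ≤ h) (hl : 0 ≤ l) (hhl : h ≤ 2 * l) (hγ0 : 0 ≤ γ)
    (hγ : θ < γ) : h ^ γ * 2 ^ θ * (1 - (2 : ℝ) ^ (θ - γ))⁻¹ ≤
      2 ^ γ * (2 ^ θ * (1 - (2 : ℝ) ^ (θ - γ))⁻¹) * l ^ γ := by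
  have h1 : h ^ γ ≤ 2 ^ γ * l ^ γ := by
    rw [← Real.mul_rpow two_pos.le hl]
    exact Real.rpow_le_rpow hh hhl hγ0
  have h2 : 0 ≤ 2 ^ θ * (1 - (2 : ℝ) ^ (θ - γ))⁻¹ :=
    mul_nonneg (by positivity) (inv_one_sub_two_rpow_nonneg hγ)
  nlinarith

section Limit

variable {Ω : Type u} {mΩ : MeasurableSpace Ω} {P : Measure Ω} [IsProbabilityMeasure P]

/-- Completeness of `L_p` over a sub-σ-algebra. -/
theorem exists_tendsto_eLpNorm_of_tsum_ne_top {E : Type*} [NormedAddCommGroup E] [CompleteSpace E]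
    {m₀ : MeasurableSpace Ω} (hm₀ : m₀ ≤ mΩ) {p : ℝ≥0∞} (hp : 1 ≤ p) {f : ℕ → Ω → E}
    (hf : ∀ n, StronglyMeasurable[m₀] (f n)) (hfp : ∀ n, MemLp (f n) p P) {B : ℕ → ℝ≥0∞}
    (hB : ∑' n, B n ≠ ∞) (hfB : ∀ n, eLpNorm (f n - f (n + 1)) p P ≤ B n) :
    ∃ g, StronglyMeasurable[m₀] g ∧ MemLp g p P ∧
      Tendsto (fun n => eLpNorm (f n - g) p P) atTop (𝓝 0) := by
  have : Fact (1 ≤ p) := ⟨hp⟩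
  -- Taking the limit in `L_p` of the trimmed measure yields a representative that is genuinely
  -- `m₀`-measurable, not merely almost everywhere equal to one.
  have hf' : ∀ n, MemLp (f n) p (P.trim hm₀) := fun n =>
    ⟨(hf n).aestronglyMeasurable, by rw [eLpNorm_trim hm₀ (hf n)]; exact (hfp n).2⟩
  have hcau : CauchySeq fun n => (hf' n).toLp (f n) := by
    refine cauchySeq_of_edist_le_of_tsum_ne_top B (fun n => ?_) hB
    rw [Lp.edist_toLp_toLp, eLpNorm_trim hm₀ ((hf n).sub (hf (n + 1)))]
    exact hfB n
  obtain ⟨G, hG⟩ := cauchySeq_tendsto_of_complete hcau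
  have hGm : StronglyMeasurable[m₀] G := Lp.stronglyMeasurable G
  refine ⟨G, hGm, memLp_of_memLp_trim hm₀ (Lp.memLp G), ?_⟩
  have h1 := tendsto_iff_edist_tendsto_0.1 hG
  refine h1.congr fun n => ?_
  conv_lhs => rw [← Lp.toLp_coeFn G (Lp.memLp G)]
  rw [Lp.edist_toLp_toLp, eLpNorm_trim hm₀ ((hf n).sub hGm)]

end Limit

section Germ

variable {Ω : Type u} {mΩ : MeasurableSpace Ω} {P : Measure Ω} [IsProbabilityMeasure P]
  {d : ℕ} {m κ T : ℝ} {𝓕 : Filtration (Set.Icc (0 : ℝ) T) mΩ}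
  {A : Set.Icc (0 : ℝ) T → Set.Icc (0 : ℝ) T → Ω → EuclideanSpace ℝ (Fin d)}
  {Γ₁ Γ₂ M α β₁ β₂ θ : ℝ} {s t : Set.Icc (0 : ℝ) T}

namespace IsSewingGerm

/-- Telescoping from level `n₁`, whose step is comparable to `t - s`: the first term is a single
`δA` and contributes the `1` in `sewingConst₁`; the refinements contribute the geometric series,
uniformly in `N`. -/
theorem eLpNorm_condExp_sub_gridSum_le (hA : IsSewingGerm P 𝓕 A m Γ₁ Γ₂ M α β₁ β₂)
    (hm : 2 ≤ m) (hΓ₁ : 0 ≤ Γ₁) (hM : 0 ≤ M) (hα : 0 ≤ α) (hβ₁ : 1 < β₁) (hst : s < t) {n₁ : ℕ}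
    (hl : (t : ℝ) - s ≤ T * ((2 : ℝ) ^ n₁)⁻¹) (hl2 : T * ((2 : ℝ) ^ n₁)⁻¹ ≤ 2 * ((t : ℝ) - s))
    {t₀ : Set.Icc (0 : ℝ) T} (ht₀ : t₀ < s) (hr : M * ((t : ℝ) - s) ≤ (s : ℝ) - t₀) (N : ℕ) :
    eLpNorm (P[A s t - gridSum A s t (n₁ + N) | 𝓕 t₀]) (ENNReal.ofReal m) P ≤
      ENNReal.ofReal (sewingConst₁ β₁ * Γ₁ * ((s : ℝ) - t₀) ^ (-α) * ((t : ℝ) - s) ^ β₁) := by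
  have hp := one_le_ofReal_of_two_le hm
  have hst' : (s : ℝ) < t := hst
  have hs0 : 0 ≤ (s : ℝ) - t₀ := sub_nonneg.2 (Subtype.coe_le_coe.2 ht₀.le)
  have hT : 0 < T := by linarith [s.2.1, t.2.2]
  have hdiff : ∀ k, Integrable (gridSum A s t (n₁ + k) - gridSum A s t (n₁ + k + 1)) P := fun k =>
    ((hA.memLp_gridSum hT.le _).sub (hA.memLp_gridSum hT.le _)).integrable hp
  have hfirst : Integrable (A s t - gridSum A s t n₁) P :=
    ((hA.memLp s t hst.le).sub (hA.memLp_gridSum hT.le _)).integrable hp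
  set c := Γ₁ * ((s : ℝ) - t₀) ^ (-α) with hc
  have hc0 : 0 ≤ c := mul_nonneg hΓ₁ (Real.rpow_nonneg hs0 _)
  rw [sub_gridSum_eq, eLpNorm_congr_ae ((condExp_add hfirst
    (integrable_finsetSum' _ fun k _ => hdiff k) _).trans
    (EventuallyEq.add EventuallyEq.rfl (condExp_finsetSum (fun k _ => hdiff k) _)))]
  refine (eLpNorm_add_le integrable_condExp.aestronglyMeasurable
    (Finset.aestronglyMeasurable_sum _ fun k _ => integrable_condExp.aestronglyMeasurable)
    hp).trans ?_
  have h1 : eLpNorm (P[A s t - gridSum A s t n₁ | 𝓕 t₀]) (ENNReal.ofReal m) P ≤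
      ENNReal.ofReal (c * ((t : ℝ) - s) ^ β₁) := by
    obtain ⟨p, hsp, hpt, hp⟩ := exists_sub_gridSum_eq hA.diag hT hst.le hl
    rw [hp]
    exact hA.eLpNorm_condExp_sewDelta_le hΓ₁ hM hα (by linarith) ht₀ hr le_rfl hsp hpt le_rfl le_rfl
  have h2 := eLpNorm_sum_le_of_hasSum (P := P) hm
    (f := fun k => P[gridSum A s t (n₁ + k) - gridSum A s t (n₁ + k + 1) | 𝓕 t₀])
    (fun k => integrable_condExp.aestronglyMeasurable)
    (fun k => hA.eLpNorm_condExp_gridSum_sub_succ_le hm hΓ₁ hM hα (by linarith) hT hst.le hl ht₀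
      hr k) (fun k => by positivity)
    ((hasSum_dyadic (h := T * ((2 : ℝ) ^ n₁)⁻¹) (by positivity) hβ₁).mul_left c) N
  refine (add_le_add h1 h2).trans ?_
  have hl0 : 0 ≤ (t : ℝ) - s := by linarith
  have hpos : 0 ≤ (1 - (2 : ℝ) ^ (1 - β₁))⁻¹ := inv_one_sub_two_rpow_nonneg hβ₁
  rw [← ENNReal.ofReal_add (by positivity) (by positivity)]
  refine ENNReal.ofReal_le_ofReal ?_
  have h3 := dyadic_sum_le (h := T * ((2 : ℝ) ^ n₁)⁻¹) (by positivity) hl0 hl2 (by linarith) hβ₁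
  calc _ ≤ c * ((t : ℝ) - s) ^ β₁ + c * (2 ^ β₁ * (2 ^ (1 : ℝ) * (1 - (2 : ℝ) ^ (1 - β₁))⁻¹) *
        ((t : ℝ) - s) ^ β₁) := by gcongr
    _ = _ := by rw [hc, sewingConst₁, Real.rpow_one]; ring

/-- The same telescoping as for the conditional bound, now with the BDG estimate at every scale,
which produces two geometric series, with ratios `2 ^ (1/2 - β₂)` and `2 ^ (θ - (β₁ - α))`. -/
theorem eLpNorm_sub_gridSum_le (hA : IsSewingGerm P 𝓕 A m Γ₁ Γ₂ M α β₁ β₂)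
    (hκ : IsBDGConstant.{u} m d κ) (hm : 2 ≤ m) (hκ0 : 0 ≤ κ) (hΓ₁ : 0 ≤ Γ₁) (hΓ₂ : 0 ≤ Γ₂)
    (hM : 0 ≤ M) (hα : 0 ≤ α) (hβ₁ : 1 < β₁) (hβ₂ : 1 / 2 < β₂) (hβα : 1 / 2 < β₁ - α)
    (hst : s < t) {n₁ : ℕ}
    (hl : (t : ℝ) - s ≤ T * ((2 : ℝ) ^ n₁)⁻¹) (hl2 : T * ((2 : ℝ) ^ n₁)⁻¹ ≤ 2 * ((t : ℝ) - s))
    (N : ℕ) :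
    eLpNorm (A s t - gridSum A s t (n₁ + N)) (ENNReal.ofReal m) P ≤
      ENNReal.ofReal (sewingConst₂ α β₁ β₂ M * (κ * Γ₁) * ((t : ℝ) - s) ^ (β₁ - α) +
        sewingConst₃ α β₁ β₂ M * (κ * Γ₂) * ((t : ℝ) - s) ^ β₂) := by
  have hp := one_le_ofReal_of_two_le hm
  have hst' : (s : ℝ) < t := hst
  have hT : 0 < T := by linarith [s.2.1, t.2.2]
  set θ := sewingExponent α β₁ with hθdef
  have hmax : max (1 / 2) (1 - α) < β₁ - α := max_lt hβα (by linarith)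
  have hθ : 1 / 2 ≤ θ := by
    rw [hθdef, sewingExponent]; linarith [le_max_left (1 / 2) (1 - α)]
  have hαθ : 1 - α < θ := by
    rw [hθdef, sewingExponent]; linarith [le_max_right (1 / 2) (1 - α)]
  have hθβ : θ < β₁ - α := by rw [hθdef, sewingExponent]; linarith
  set W := windowConst M α θ with hW
  have hW0 : 0 ≤ W := windowConst_nonneg _ _ _
  set h := T * ((2 : ℝ) ^ n₁)⁻¹ with hh
  have hh0 : 0 ≤ h := by positivity
  have hl0 : 0 ≤ (t : ℝ) - s := by linarith
  rw [sub_gridSum_eq]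
  refine (eLpNorm_add_le ((hA.memLp s t hst.le).sub (hA.memLp_gridSum hT.le _)).1
    (Finset.aestronglyMeasurable_sum _ fun k _ =>
      ((hA.memLp_gridSum hT.le _).sub (hA.memLp_gridSum hT.le _)).1) hp).trans ?_
  have h1 : eLpNorm (A s t - gridSum A s t n₁) (ENNReal.ofReal m) P ≤
      ENNReal.ofReal (W * (κ *
        (Γ₂ * ((t : ℝ) - s) ^ β₂ + Γ₁ * ((t : ℝ) - s) ^ (β₁ - α)))) := by
    obtain ⟨p, hsp, hpt, hp⟩ := exists_sub_gridSum_eq hA.diag hT hst.le hl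
    rw [hp]
    exact hA.eLpNorm_sewDelta_le hκ hm hκ0 hΓ₁ hΓ₂ hM hα hθ hαθ hst hsp hpt
  have h2 := eLpNorm_sum_le_of_hasSum (P := P) hm
    (f := fun k => gridSum A s t (n₁ + k) - gridSum A s t (n₁ + k + 1))
    (fun k => ((hA.memLp_gridSum hT.le _).sub (hA.memLp_gridSum hT.le _)).1)
    (fun k => hA.eLpNorm_gridSum_sub_succ_le hκ hm hκ0 hΓ₁ hΓ₂ hM hα (by linarith) (by linarith)
      hθ hαθ hT hst.le hl k) (fun k => by positivity)
    (((((hasSum_dyadic hh0 hβ₂).mul_left Γ₂).add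
      ((hasSum_dyadic hh0 hθβ).mul_left Γ₁)).mul_left κ).mul_left W) N
  refine (add_le_add h1 h2).trans ?_
  have hpos2 := inv_one_sub_two_rpow_nonneg hβ₂
  have hpos1 := inv_one_sub_two_rpow_nonneg hθβ
  rw [← ENNReal.ofReal_add (by positivity) (by positivity)]
  refine ENNReal.ofReal_le_ofReal ?_
  have h3 := dyadic_sum_le hh0 hl0 hl2 (by linarith) hβ₂
  have h4 := dyadic_sum_le hh0 hl0 hl2 (by linarith) hθβ
  calc _ ≤ W * (κ * (Γ₂ * ((t : ℝ) - s) ^ β₂ + Γ₁ * ((t : ℝ) - s) ^ (β₁ - α))) +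
        W * (κ * (Γ₂ * (2 ^ β₂ * (2 ^ (1 / 2 : ℝ) * (1 - (2 : ℝ) ^ (1 / 2 - β₂))⁻¹) *
          ((t : ℝ) - s) ^ β₂) + Γ₁ * (2 ^ (β₁ - α) * (2 ^ θ *
          (1 - (2 : ℝ) ^ (θ - (β₁ - α)))⁻¹) * ((t : ℝ) - s) ^ (β₁ - α)))) := by gcongr
    _ = _ := by rw [sewingConst₂, sewingConst₃, ← hθdef, ← hW]; ring

end IsSewingGerm

end Germ

/-! ### Existence of the sewn process -/

section Germ

variable {Ω : Type u} {mΩ : MeasurableSpace Ω} {P : Measure Ω} [IsProbabilityMeasure P]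
  {d : ℕ} {m κ T : ℝ} {𝓕 : Filtration (Set.Icc (0 : ℝ) T) mΩ}
  {A : Set.Icc (0 : ℝ) T → Set.Icc (0 : ℝ) T → Ω → EuclideanSpace ℝ (Fin d)}
  {Γ₁ Γ₂ M α β₁ β₂ θ : ℝ} {s t : Set.Icc (0 : ℝ) T}

theorem le_of_tendsto_eLpNorm_sub {p : ℝ≥0∞} (hp : 1 ≤ p) {E : Type*} [NormedAddCommGroup E]
    {f : ℕ → Ω → E} {g : Ω → E} (hf : ∀ n, AEStronglyMeasurable (f n) P)
    (hg : AEStronglyMeasurable g P)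
    (h : Tendsto (fun n => eLpNorm (g - f n) p P) atTop (𝓝 0)) {C : ℝ≥0∞}
    (hC : ∀ n, eLpNorm (f n) p P ≤ C) : eLpNorm g p P ≤ C := by
  have h1 : Tendsto (fun n => eLpNorm (g - f n) p P + C) atTop (𝓝 (0 + C)) := h.add_const C
  rw [zero_add] at h1
  refine ge_of_tendsto h1 (Eventually.of_forall fun n => ?_)
  calc eLpNorm g p P = eLpNorm (g - f n + f n) p P := by rw [sub_add_cancel]
    _ ≤ eLpNorm (g - f n) p P + eLpNorm (f n) p P := eLpNorm_add_le (hg.sub (hf n)) (hf n) hp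
    _ ≤ _ := by gcongr; exact hC n

namespace IsSewingGerm

theorem exists_tendsto_gridSum (hA : IsSewingGerm P 𝓕 A m Γ₁ Γ₂ M α β₁ β₂) (hm : 2 ≤ m)
    (hΓ₁ : 0 ≤ Γ₁) (hΓ₂ : 0 ≤ Γ₂) (hM : 0 ≤ M) (hα : 0 ≤ α) (hβ₁ : 1 < β₁) (hβ₂ : 1 / 2 < β₂)
    (hβα : 1 / 2 < β₁ - α) (hT : 0 < T) (hst : s ≤ t) :
    ∃ g, StronglyMeasurable[𝓕 t] g ∧ MemLp g (ENNReal.ofReal m) P ∧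
      Tendsto (fun n => eLpNorm (gridSum A s t n - g) (ENNReal.ofReal m) P) atTop (𝓝 0) := by
  set θ := sewingExponent α β₁ with hθdef
  have hmax : max (1 / 2) (1 - α) < β₁ - α := max_lt hβα (by linarith)
  have hθ : 1 / 2 ≤ θ := by
    rw [hθdef, sewingExponent]; linarith [le_max_left (1 / 2) (1 - α)]
  have hαθ : 1 - α < θ := by
    rw [hθdef, sewingExponent]; linarith [le_max_right (1 / 2) (1 - α)]
  have hθβ : θ < β₁ - α := by rw [hθdef, sewingExponent]; linarith
  have hh0 : 0 ≤ T * ((2 : ℝ) ^ 0)⁻¹ := by positivity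
  have hsum := ((((hasSum_dyadic hh0 hβ₂).mul_left Γ₂).add
    ((hasSum_dyadic hh0 hθβ).mul_left Γ₁)).mul_left (bdgConst.{u} m d)).mul_left
    (windowConst M α θ)
  refine exists_tendsto_eLpNorm_of_tsum_ne_top (𝓕.le t) (one_le_ofReal_of_two_le hm)
    (hA.adapted_gridSum hT.le hst) (hA.memLp_gridSum hT.le) hsum.summable.tsum_ofReal_ne_top
    (fun n => ?_)
  have := hA.eLpNorm_gridSum_sub_succ_le (isBDGConstant_bdgConst.{u} hm d) hm
    (bdgConst_nonneg.{u} m d) hΓ₁ hΓ₂ hM hα (by linarith) (by linarith) hθ hαθ hT hst (n₁ := 0)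
    (by simp; linarith [s.2.1, t.2.2]) n
  rw [zero_add] at this
  exact this

/-- The defect of additivity is one straddling cell, of size at most `Γ₂ h ^ β₂`, so the limits of
the grid sums have additive increments. -/
theorem tendsto_gridSum_sub_sub (hA : IsSewingGerm P 𝓕 A m Γ₁ Γ₂ M α β₁ β₂) (hΓ₂ : 0 ≤ Γ₂)
    (hβ₂ : 1 / 2 < β₂) (hT : 0 < T) (hst : s < t) {z : Set.Icc (0 : ℝ) T} (hz : (z : ℝ) = 0) :
    Tendsto (fun n => eLpNorm (gridSum A z t n - gridSum A z s n - gridSum A s t n)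
      (ENNReal.ofReal m) P) atTop (𝓝 0) := by
  have hh : Tendsto (fun n : ℕ => T * ((2 : ℝ) ^ n)⁻¹) atTop (𝓝 0) := by
    have := (tendsto_inv_atTop_zero.comp
      (tendsto_pow_atTop_atTop_of_one_lt (one_lt_two (α := ℝ)))).const_mul T
    simpa using this
  have hlim : Tendsto (fun n : ℕ => ENNReal.ofReal (Γ₂ * (T * ((2 : ℝ) ^ n)⁻¹) ^ β₂)) atTop
      (𝓝 0) := by
    have h1 := (hh.rpow_const (p := β₂) (Or.inr (by linarith))).const_mul Γ₂
    rw [Real.zero_rpow (by linarith), mul_zero] at h1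
    simpa using ENNReal.tendsto_ofReal h1
  refine tendsto_of_tendsto_of_tendsto_of_le_of_le tendsto_const_nhds hlim (fun _ => zero_le)
    fun n => ?_
  obtain ⟨a, c, ha, hc, hca, he⟩ := exists_gridSum_sub_sub_eq hA.diag hT hst hz n
  simp only [he]
  rcases ha.eq_or_lt with h | h
  · simp [sewDelta_eq_zero hA.diag (Or.inl h)]
  · have hac : 0 ≤ (c : ℝ) - a := sub_nonneg.2 (Subtype.coe_le_coe.2 (h.trans hc).le)
    refine (hA.bound a s c h hc).trans (ENNReal.ofReal_le_ofReal ?_)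
    gcongr

/-- Existence in the stochastic sewing lemma, with the bounds on the constants. -/
theorem exists_sewing (hA : IsSewingGerm P 𝓕 A m Γ₁ Γ₂ M α β₁ β₂) (hm : 2 ≤ m)
    (hΓ₁ : 0 ≤ Γ₁) (hΓ₂ : 0 ≤ Γ₂) (hM : 0 ≤ M) (hα : 0 ≤ α) (hβ₁ : 1 < β₁) (hβ₂ : 1 / 2 < β₂)
    (hβα : 1 / 2 < β₁ - α) (hT : 0 ≤ T) :
    ∃ 𝒜 : Set.Icc (0 : ℝ) T → Ω → EuclideanSpace ℝ (Fin d),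
      (∀ t : Set.Icc (0 : ℝ) T, (t : ℝ) = 0 → 𝒜 t =ᵐ[P] 0) ∧
      (∀ t, StronglyMeasurable[𝓕 t] (𝒜 t)) ∧ (∀ t, MemLp (𝒜 t) (ENNReal.ofReal m) P) ∧
      SewingBounds P 𝓕 A m M α β₁ β₂ 𝒜 (sewingConst₁ β₁ * Γ₁)
        (sewingConst₂ α β₁ β₂ M * (bdgConst.{u} m d * Γ₁))
        (sewingConst₃ α β₁ β₂ M * (bdgConst.{u} m d * Γ₂)) := by
  have hp := one_le_ofReal_of_two_le hm
  have hp0 : ENNReal.ofReal m ≠ 0 := (zero_lt_one.trans_le hp).ne'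
  rcases hT.eq_or_lt with hT | hT
  · have hno : ∀ t₁ t₂ : Set.Icc (0 : ℝ) T, ¬ t₁ < t₂ := fun t₁ t₂ h => by
      have h' : (t₁ : ℝ) < t₂ := h
      linarith [t₁.2.1, t₂.2.2]
    exact ⟨0, fun _ _ => EventuallyEq.rfl, fun _ => stronglyMeasurable_zero, fun _ => MemLp.zero,
      fun _ t₁ t₂ _ h => absurd h (hno t₁ t₂), fun t₁ t₂ h => absurd h (hno t₁ t₂)⟩
  let z : Set.Icc (0 : ℝ) T := ⟨0, le_rfl, hT.le⟩
  have hz : ∀ t, z ≤ t := fun t => t.2.1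
  choose 𝒜 h𝒜m h𝒜p h𝒜 using fun t => hA.exists_tendsto_gridSum hm hΓ₁ hΓ₂ hM hα hβ₁ hβ₂ hβα hT
    (hz t)
  have hinc : ∀ s t, s < t → Tendsto (fun n => eLpNorm (𝒜 t - 𝒜 s - gridSum A s t n)
      (ENNReal.ofReal m) P) atTop (𝓝 0) := by
    intro s t hst
    have h1 := ((h𝒜 t).add (h𝒜 s)).add
      (hA.tendsto_gridSum_sub_sub hΓ₂ hβ₂ hT hst (z := z) rfl)
    simp only [add_zero] at h1
    refine tendsto_of_tendsto_of_tendsto_of_le_of_le tendsto_const_nhds h1 (fun _ => zero_le)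
      fun n => ?_
    have hgt := (hA.memLp_gridSum (s := z) (t := t) hT.le n).1
    have hgs := (hA.memLp_gridSum (s := z) (t := s) hT.le n).1
    have hg := (hA.memLp_gridSum (s := s) (t := t) hT.le n).1
    have e : 𝒜 t - 𝒜 s - gridSum A s t n = -(gridSum A z t n - 𝒜 t) + (gridSum A z s n - 𝒜 s) +
        (gridSum A z t n - gridSum A z s n - gridSum A s t n) := by abel
    dsimp only
    rw [e]
    refine (eLpNorm_add_le (((hgt.sub (h𝒜p t).1).neg).add (hgs.sub (h𝒜p s).1))
      ((hgt.sub hgs).sub hg) hp).trans ?_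
    gcongr
    refine (eLpNorm_add_le ((hgt.sub (h𝒜p t).1).neg) (hgs.sub (h𝒜p s).1) hp).trans ?_
    rw [eLpNorm_neg]
  have hlevel : ∀ s t : Set.Icc (0 : ℝ) T, s < t → ∃ n₁ : ℕ,
      (t : ℝ) - s ≤ T * ((2 : ℝ) ^ n₁)⁻¹ ∧ T * ((2 : ℝ) ^ n₁)⁻¹ ≤ 2 * ((t : ℝ) - s) := by
    intro s t hst
    have hst' : (s : ℝ) < t := hst
    -- The step at this level is at least `t - s`, so at most one grid point falls strictly inside,
    -- and at most `2 (t - s)`, so powers of the step turn into powers of `t - s`; this is the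
    -- source of `2 ^ β₁`, `2 ^ (β₁ - α)` and `2 ^ β₂` in the constants.
    obtain ⟨l, h1, h2⟩ := exists_dyadic_class hT (sub_pos.2 hst') (by linarith [s.2.1, t.2.2])
    refine ⟨l, h2, ?_⟩
    rw [pow_succ, mul_inv] at h1
    linarith
  have hshift : ∀ s t, s < t → ∀ n₁ : ℕ, Tendsto (fun N => eLpNorm (𝒜 t - 𝒜 s - A s t -
      (-(A s t - gridSum A s t (n₁ + N)))) (ENNReal.ofReal m) P) atTop (𝓝 0) := by
    intro s t hst n₁
    refine ((hinc s t hst).comp (tendsto_add_atTop_nat n₁)).congr fun N => ?_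
    dsimp only [Function.comp]
    rw [add_comm N n₁]
    congr 1
    abel
  refine ⟨𝒜, ?_, h𝒜m, h𝒜p, ?_, ?_⟩
  · intro t ht
    obtain rfl : t = z := Subtype.ext ht
    have h0 : ∀ n, gridSum A z z n = 0 := fun n => Finset.sum_eq_zero fun j _ => by
      have hc : ∀ x, clip z z x = z := fun x => le_antisymm (clip_le_right le_rfl) left_le_clip
      rw [hc, hc, hA.diag]
    have h1 := h𝒜 z
    simp only [h0, zero_sub, eLpNorm_neg] at h1
    exact (eLpNorm_eq_zero_iff (h𝒜p z).1 hp0).1 (tendsto_nhds_unique tendsto_const_nhds h1)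
  · intro t₀ s t ht₀ hst hr
    obtain ⟨n₁, hl, hl2⟩ := hlevel s t hst
    have hgi : ∀ N, Integrable (A s t - gridSum A s t (n₁ + N)) P := fun N =>
      ((hA.memLp s t hst.le).sub (hA.memLp_gridSum hT.le _)).integrable hp
    have hDi : Integrable (𝒜 t - 𝒜 s - A s t) P :=
      (((h𝒜p t).sub (h𝒜p s)).sub (hA.memLp s t hst.le)).integrable hp
    refine le_of_tendsto_eLpNorm_sub hp
      (f := fun N => P[-(A s t - gridSum A s t (n₁ + N)) | 𝓕 t₀])
      (fun N => integrable_condExp.aestronglyMeasurable) integrable_condExp.aestronglyMeasurable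
      ?_ (fun N => ?_)
    -- Conditional expectation is an `L_m` contraction, so `L_m` convergence of the grid sums
    -- carries over to their conditional expectations.
    · refine tendsto_of_tendsto_of_tendsto_of_le_of_le tendsto_const_nhds (hshift s t hst n₁)
        (fun _ => zero_le) fun N => ?_
      dsimp only
      change eLpNorm (P[𝒜 t - 𝒜 s - A s t | 𝓕 t₀] - _) _ P ≤ _
      rw [← eLpNorm_congr_ae (condExp_sub hDi (hgi N).neg _)]
      exact eLpNorm_condExp_le_eLpNorm _ hp
    · rw [eLpNorm_congr_ae (condExp_neg _ _), eLpNorm_neg]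
      exact hA.eLpNorm_condExp_sub_gridSum_le hm hΓ₁ hM hα hβ₁ hst hl hl2 ht₀ hr N
  · intro s t hst
    obtain ⟨n₁, hl, hl2⟩ := hlevel s t hst
    refine le_of_tendsto_eLpNorm_sub hp (f := fun N => -(A s t - gridSum A s t (n₁ + N)))
      (fun N => ((hA.memLp s t hst.le).sub (hA.memLp_gridSum hT.le _)).1.neg)
      (((h𝒜p t).sub (h𝒜p s)).sub (hA.memLp s t hst.le)).1 (hshift s t hst n₁) (fun N => ?_)
    rw [eLpNorm_neg]
    exact hA.eLpNorm_sub_gridSum_le (isBDGConstant_bdgConst.{u} hm d) hm (bdgConst_nonneg.{u} m d)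
      hΓ₁ hΓ₂ hM hα hβ₁ hβ₂ hβα hst hl hl2 N

end IsSewingGerm

end Germ

/-! ### Convergence of Riemann sums and uniqueness -/

section Uniqueness

variable {Ω : Type u} {mΩ : MeasurableSpace Ω} {P : Measure Ω} [IsProbabilityMeasure P]
  {d : ℕ} {m T : ℝ} {𝓕 : Filtration (Set.Icc (0 : ℝ) T) mΩ}
  {A : Set.Icc (0 : ℝ) T → Set.Icc (0 : ℝ) T → Ω → EuclideanSpace ℝ (Fin d)}
  {M α β₁ β₂ : ℝ} {𝒜 𝒜' : Set.Icc (0 : ℝ) T → Ω → EuclideanSpace ℝ (Fin d)}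

theorem PartitionUpTo.riemannSum_sub {τ : Set.Icc (0 : ℝ) T} (π : PartitionUpTo τ) :
    π.riemannSum (fun s t => 𝒜 t - 𝒜 s - A s t) =
      𝒜 τ - 𝒜 (π.pt 0) - π.riemannSum A := by
  funext ω
  simp only [PartitionUpTo.riemannSum, Pi.sub_apply, Finset.sum_sub_distrib]
  rw [← Finset.sum_sub_distrib, Finset.sum_range_sub (fun i => 𝒜 (π.pt i) ω), π.pt_last]

/-- The defining bounds of a sewing make its remainders eligible for the partition estimate,
whatever the constants. This is why neither convergence nor uniqueness refers to the construction of
`𝒜`. -/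
theorem SewingBounds.isLocalized {C₁ C₂ C₃ : ℝ}
    (h : SewingBounds P 𝓕 A m M α β₁ β₂ 𝒜 C₁ C₂ C₃)
    (hA : ∀ s t, s ≤ t → StronglyMeasurable[𝓕 t] (A s t))
    (h𝒜 : ∀ t, StronglyMeasurable[𝓕 t] (𝒜 t)) {s t : Set.Icc (0 : ℝ) T} (hst : s < t) :
    IsLocalized P 𝓕 m (M * ((t : ℝ) - s)) α
      (C₂ * ((t : ℝ) - s) ^ (β₁ - α) + C₃ * ((t : ℝ) - s) ^ β₂)
      (C₁ * ((t : ℝ) - s) ^ β₁) s t (𝒜 t - 𝒜 s - A s t) where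
  measurable := ((h𝒜 t).sub ((h𝒜 s).mono (𝓕.mono hst.le))).sub (hA s t hst.le)
  bound := h.2 s t hst
  condBound t₀ ht₀ hr := by
    rw [mul_right_comm]
    exact h.1 t₀ s t ht₀ hst hr

/-- The Riemann sums converge to any process with the properties of the sewing lemma. -/
theorem IsSewing.tendsto_riemannSum (h : IsSewing P 𝓕 A m M α β₁ β₂ 𝒜) (hm : 2 ≤ m)
    (hA : ∀ s t, s ≤ t → StronglyMeasurable[𝓕 t] (A s t)) (hM : 0 ≤ M) (hα : 0 ≤ α)
    (hβ₁ : 1 < β₁) (hβ₂ : 1 / 2 < β₂) (hβα : 1 / 2 < β₁ - α) (τ : Set.Icc (0 : ℝ) T) :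
    Tendsto (fun π : PartitionUpTo τ =>
        eLpNorm (fun ω => π.riemannSum A ω - 𝒜 τ ω) (ENNReal.ofReal m) P)
      (comap PartitionUpTo.mesh (𝓝 0)) (𝓝 0) := by
  obtain ⟨C₁, C₂, C₃, hC₁, hC₂, hC₃, hb⟩ := h.bounds
  have hnorm : ∀ π : PartitionUpTo τ,
      eLpNorm (fun ω => π.riemannSum A ω - 𝒜 τ ω) (ENNReal.ofReal m) P =
      eLpNorm (π.riemannSum fun s t => 𝒜 t - 𝒜 s - A s t) (ENNReal.ofReal m) P := by
    intro π
    rw [π.riemannSum_sub, ← eLpNorm_neg]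
    refine eLpNorm_congr_ae ?_
    filter_upwards [h.initial (π.pt 0) π.pt_zero] with ω hω
    simp [hω]
  simp_rw [hnorm]
  rcases (τ.2.1.trans τ.2.2).eq_or_lt with hT | hT
  · refine tendsto_const_nhds.congr fun π => ?_
    have hn : π.n = 0 := by
      by_contra hn
      have h1 : (π.pt 0 : ℝ) < π.pt 1 := π.pt_lt 0 (Nat.pos_of_ne_zero hn)
      linarith [(π.pt 0).2.1, (π.pt 1).2.2]
    have : (π.riemannSum fun s t => 𝒜 t - 𝒜 s - A s t) = 0 := by
      funext ω; simp [PartitionUpTo.riemannSum, hn]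
    rw [this, eLpNorm_zero]
  set θ := sewingExponent α β₁ with hθdef
  have hmax : max (1 / 2) (1 - α) < β₁ - α := max_lt hβα (by linarith)
  have hθ : 1 / 2 ≤ θ := by
    rw [hθdef, sewingExponent]; linarith [le_max_left (1 / 2) (1 - α)]
  have hαθ : 1 - α < θ := by
    rw [hθdef, sewingExponent]; linarith [le_max_right (1 / 2) (1 - α)]
  have hθβ : θ < β₁ - α := by rw [hθdef, sewingExponent]; linarith
  -- The tails of the summable series `classBound` tend to zero; a mesh below `T / 2 ^ l₀` makes the
  -- tail from `l₀` an upper bound.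
  have htail := ENNReal.tendsto_sum_nat_add _ (summable_classBound (M := M)
    (κ := bdgConst.{u} m d) (C₁ := C₁) (C₂ := C₂) (C₃ := C₃) hT.le hθ hθβ hβ₂).tsum_ofReal_ne_top
  rw [ENNReal.tendsto_nhds_zero] at htail ⊢
  intro ε hε
  obtain ⟨l₀, hl₀⟩ := (htail ε hε).exists
  have hev : ∀ᶠ x : ℝ in 𝓝 0, x ≤ T * ((2 : ℝ) ^ l₀)⁻¹ := eventually_le_nhds (by positivity)
  filter_upwards [tendsto_comap.eventually hev] with π hπ
  refine le_trans ?_ hl₀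
  exact (isBDGConstant_bdgConst.{u} hm d).eLpNorm_sum_partition_le hm (bdgConst_nonneg.{u} m d) hT
    hM hα hθ hαθ (by linarith) (by linarith) (by linarith) hC₁ hC₂ hC₃
    (fun s t hst => hb.isLocalized hA h.adapted hst) π l₀ hπ

theorem PartitionUpTo.exists_mesh_lt (τ : Set.Icc (0 : ℝ) T) {ε : ℝ} (hε : 0 < ε) :
    ∃ π : PartitionUpTo τ, |π.mesh| < ε := by
  rcases τ.2.1.eq_or_lt with hτ | hτ
  · refine ⟨⟨0, fun _ => τ, by simp, hτ.symm, rfl⟩, ?_⟩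
    rw [PartitionUpTo.mesh, Real.iSup_of_isEmpty]
    simpa using hε
  obtain ⟨N, hN⟩ := exists_nat_gt ((τ : ℝ) / ε)
  have hN0 : (0 : ℝ) < N := (div_pos hτ hε).trans hN
  have hstep : 0 < (τ : ℝ) / N := by positivity
  have hval : ∀ i : ℕ, i ≤ N → min (τ : ℝ) (i * (τ / N)) = i * (τ / N) := by
    intro i hi
    have hi' : (i : ℝ) ≤ N := by exact_mod_cast hi
    refine min_eq_right ?_
    calc (i : ℝ) * (τ / N) ≤ N * (τ / N) := by gcongr
      _ = τ := by field_simp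
  let π : PartitionUpTo τ :=
    { n := N
      pt := fun i => ⟨min (τ : ℝ) (i * (τ / N)), le_min τ.2.1 (by positivity),
        (min_le_left _ _).trans τ.2.2⟩
      pt_lt := fun i hi => by
        rw [← Subtype.coe_lt_coe]
        change min (τ : ℝ) (i * (τ / N)) < min (τ : ℝ) ((i + 1 : ℕ) * (τ / N))
        rw [hval i hi.le, hval (i + 1) hi]
        gcongr
        exact Nat.lt_succ_self i
      pt_zero := by simp [τ.2.1]
      pt_last := Subtype.ext (by
        change min (τ : ℝ) (N * (τ / N)) = τ
        rw [hval N le_rfl]; field_simp) }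
  refine ⟨π, ?_⟩
  have hlen : ∀ i : Fin π.n, |(π.pt (i + 1) : ℝ) - π.pt i| = τ / N := by
    intro i
    change |min (τ : ℝ) ((i + 1 : ℕ) * (τ / N)) - min (τ : ℝ) (i * (τ / N))| = τ / N
    rw [hval _ i.2, hval _ i.2.le]
    push_cast
    rw [add_mul, one_mul, add_sub_cancel_left, abs_of_pos hstep]
  have hne : Nonempty (Fin π.n) := ⟨⟨0, by exact_mod_cast hN0⟩⟩
  rw [PartitionUpTo.mesh]
  simp_rw [hlen]
  rw [ciSup_const, abs_of_pos hstep, div_lt_iff₀ hN0]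
  rw [div_lt_iff₀ hε] at hN
  linarith

/-- Without partitions of arbitrarily small mesh, convergence along this filter would be vacuous and
could not identify a limit. -/
instance PartitionUpTo.neBot_comap_mesh (τ : Set.Icc (0 : ℝ) T) :
    (comap (PartitionUpTo.mesh (τ := τ)) (𝓝 0)).NeBot := by
  refine comap_neBot fun U hU => ?_
  obtain ⟨ε, hε, hU⟩ := Metric.mem_nhds_iff.1 hU
  obtain ⟨π, hπ⟩ := PartitionUpTo.exists_mesh_lt τ hε
  exact ⟨π, hU (by simpa using hπ)⟩

/-- Both processes are `L_m` limits of the same Riemann sums along a nontrivial filter. -/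
theorem IsSewing.ae_eq (h : IsSewing P 𝓕 A m M α β₁ β₂ 𝒜) (h' : IsSewing P 𝓕 A m M α β₁ β₂ 𝒜')
    (hm : 2 ≤ m) (hA : ∀ s t, s ≤ t → StronglyMeasurable[𝓕 t] (A s t)) (hM : 0 ≤ M)
    (hα : 0 ≤ α) (hβ₁ : 1 < β₁) (hβ₂ : 1 / 2 < β₂) (hβα : 1 / 2 < β₁ - α)
    (τ : Set.Icc (0 : ℝ) T) : 𝒜' τ =ᵐ[P] 𝒜 τ := by
  have hp := one_le_ofReal_of_two_le hm
  have h1 := (h.tendsto_riemannSum hm hA hM hα hβ₁ hβ₂ hβα τ).add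
    (h'.tendsto_riemannSum hm hA hM hα hβ₁ hβ₂ hβα τ)
  rw [add_zero] at h1
  have hle : eLpNorm (𝒜' τ - 𝒜 τ) (ENNReal.ofReal m) P ≤ 0 := by
    refine ge_of_tendsto h1 (Eventually.of_forall fun π => ?_)
    have hπ : StronglyMeasurable (π.riemannSum A) :=
      Finset.stronglyMeasurable_fun_sum _ fun i hi =>
        (hA _ _ (π.pt_lt i (Finset.mem_range.1 hi)).le).mono (𝓕.le _)
    have e : 𝒜' τ - 𝒜 τ = (π.riemannSum A - 𝒜 τ) - (π.riemannSum A - 𝒜' τ) := by abel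
    rw [e]
    exact eLpNorm_sub_le (hπ.aestronglyMeasurable.sub (h.memLp τ).1)
      (hπ.aestronglyMeasurable.sub (h'.memLp τ).1) hp
  have h2 := (eLpNorm_eq_zero_iff ((h'.memLp τ).1.sub (h.memLp τ).1)
    (zero_lt_one.trans_le hp).ne').1 (le_antisymm hle zero_le)
  filter_upwards [h2] with ω hω
  exact sub_eq_zero.1 hω

end Uniqueness

/-! ### Reduction to a vanishing diagonal, and the theorem -/

section OffDiagonal

variable {Ω E : Type*} [AddCommGroup E] {T : ℝ}

open Classical in
/-- The germ that agrees with `A` off the diagonal and vanishes on it. -/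
noncomputable def offDiagonal (A : Set.Icc (0 : ℝ) T → Set.Icc (0 : ℝ) T → Ω → E)
    (s t : Set.Icc (0 : ℝ) T) : Ω → E :=
  if s = t then 0 else A s t

theorem offDiagonal_self (A : Set.Icc (0 : ℝ) T → Set.Icc (0 : ℝ) T → Ω → E)
    (s : Set.Icc (0 : ℝ) T) : offDiagonal A s s = 0 := if_pos rfl

theorem offDiagonal_of_lt (A : Set.Icc (0 : ℝ) T → Set.Icc (0 : ℝ) T → Ω → E)
    {s t : Set.Icc (0 : ℝ) T} (h : s < t) : offDiagonal A s t = A s t := if_neg h.ne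

theorem sewDelta_offDiagonal (A : Set.Icc (0 : ℝ) T → Set.Icc (0 : ℝ) T → Ω → E)
    {s u t : Set.Icc (0 : ℝ) T} (h : s < u) (h' : u < t) :
    sewDelta (offDiagonal A) s u t = sewDelta A s u t := by
  rw [sewDelta_eq, sewDelta_eq, offDiagonal_of_lt A h, offDiagonal_of_lt A h',
    offDiagonal_of_lt A (h.trans h')]

end OffDiagonal

theorem SewingBounds.of_offDiagonal {Ω : Type*} {mΩ : MeasurableSpace Ω} {P : Measure Ω} {d : ℕ}
    {T : ℝ} {𝓕 : Filtration (Set.Icc (0 : ℝ) T) mΩ}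
    {A : Set.Icc (0 : ℝ) T → Set.Icc (0 : ℝ) T → Ω → EuclideanSpace ℝ (Fin d)}
    {m M α β₁ β₂ C₁ C₂ C₃ : ℝ} {𝒜 : Set.Icc (0 : ℝ) T → Ω → EuclideanSpace ℝ (Fin d)}
    (h : SewingBounds P 𝓕 (offDiagonal A) m M α β₁ β₂ 𝒜 C₁ C₂ C₃) :
    SewingBounds P 𝓕 A m M α β₁ β₂ 𝒜 C₁ C₂ C₃ := by
  refine ⟨fun t₀ t₁ t₂ h01 h12 hM => ?_, fun t₁ t₂ h12 => ?_⟩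
  · have := h.1 t₀ t₁ t₂ h01 h12 hM
    rwa [offDiagonal_of_lt A h12] at this
  · have := h.2 t₁ t₂ h12
    rwa [offDiagonal_of_lt A h12] at this

theorem sewingConst₁_nonneg {β₁ : ℝ} (h : 1 < β₁) : 0 ≤ sewingConst₁ β₁ := by
  have := inv_one_sub_two_rpow_nonneg h
  rw [sewingConst₁]
  positivity

theorem sewingConst₂_nonneg {α β₁ : ℝ} (h : 1 < β₁) (h' : 1 / 2 < β₁ - α) (β₂ M : ℝ) :
    0 ≤ sewingConst₂ α β₁ β₂ M := by
  have h1 : sewingExponent α β₁ < β₁ - α := by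
    have : max (1 / 2) (1 - α) < β₁ - α := max_lt h' (by linarith)
    rw [sewingExponent]; linarith
  have h2 := inv_one_sub_two_rpow_nonneg h1
  have h3 := windowConst_nonneg M α (sewingExponent α β₁)
  rw [sewingConst₂]
  positivity

theorem sewingConst₃_nonneg {β₂ : ℝ} (h : 1 / 2 < β₂) (α β₁ M : ℝ) :
    0 ≤ sewingConst₃ α β₁ β₂ M := by
  have h2 := inv_one_sub_two_rpow_nonneg h
  have h3 := windowConst_nonneg M α (sewingExponent α β₁)
  rw [sewingConst₃]
  positivity

theorem theorem1p1 :
    ∃ (K₁ : ℝ → ℝ) (K₂ K₃ : ℝ → ℝ → ℝ → ℝ → ℝ),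
      ∀ (Ω : Type u) (mΩ : MeasurableSpace Ω) (P : Measure Ω) (_ : IsProbabilityMeasure P)
        (d : ℕ) (T : ℝ) (_ : 0 ≤ T) (𝓕 : Filtration (Set.Icc (0 : ℝ) T) mΩ)
        (A : Set.Icc (0 : ℝ) T → Set.Icc (0 : ℝ) T → Ω → EuclideanSpace ℝ (Fin d))
        (m Γ₁ Γ₂ M α β₁ β₂ : ℝ),
        2 ≤ m → 0 ≤ Γ₁ → 0 ≤ Γ₂ → 0 ≤ M → 0 ≤ α → 0 ≤ β₁ → 0 ≤ β₂ →
        (∀ s, A s s =ᵐ[P] 0) →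
        (∀ s t, s ≤ t → StronglyMeasurable[𝓕 t] (A s t)) →
        (∀ s t, s ≤ t → MemLp (A s t) (ENNReal.ofReal m) P) →
        (∀ t₀ t₁ t₂ t₃ : Set.Icc (0 : ℝ) T, t₀ < t₁ → t₁ < t₂ → t₂ < t₃ →
          M * ((t₃ : ℝ) - t₁) ≤ (t₁ : ℝ) - t₀ →
          eLpNorm (P[sewDelta A t₁ t₂ t₃ | 𝓕 t₀]) (ENNReal.ofReal m) P ≤
            ENNReal.ofReal (Γ₁ * ((t₁ : ℝ) - t₀) ^ (-α) * ((t₃ : ℝ) - t₁) ^ β₁)) →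
        (∀ t₀ t₁ t₂ : Set.Icc (0 : ℝ) T, t₀ < t₁ → t₁ < t₂ →
          eLpNorm (sewDelta A t₀ t₁ t₂) (ENNReal.ofReal m) P ≤
            ENNReal.ofReal (Γ₂ * ((t₂ : ℝ) - t₀) ^ β₂)) →
        1 < β₁ → 1 / 2 < β₂ → 1 / 2 < β₁ - α →
        ∃ 𝒜 : Set.Icc (0 : ℝ) T → Ω → EuclideanSpace ℝ (Fin d),
          IsSewing P 𝓕 A m M α β₁ β₂ 𝒜 ∧
          (∀ 𝒜' : Set.Icc (0 : ℝ) T → Ω → EuclideanSpace ℝ (Fin d),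
            IsSewing P 𝓕 A m M α β₁ β₂ 𝒜' → ∀ t, 𝒜' t =ᵐ[P] 𝒜 t) ∧
          (∃ C₁ C₂ C₃ : ℝ, 0 ≤ C₁ ∧ 0 ≤ C₂ ∧ 0 ≤ C₃ ∧
            C₁ ≤ K₁ β₁ * Γ₁ ∧
            C₂ ≤ K₂ α β₁ β₂ M * (bdgConst.{u} m d * Γ₁) ∧
            C₃ ≤ K₃ α β₁ β₂ M * (bdgConst.{u} m d * Γ₂) ∧
            SewingBounds P 𝓕 A m M α β₁ β₂ 𝒜 C₁ C₂ C₃) ∧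
          (∀ τ : Set.Icc (0 : ℝ) T,
            Tendsto
              (fun π : PartitionUpTo τ =>
                eLpNorm (fun ω => π.riemannSum A ω - 𝒜 τ ω) (ENNReal.ofReal m) P)
              (comap PartitionUpTo.mesh (𝓝 0)) (𝓝 0)) := by
  refine ⟨sewingConst₁, sewingConst₂, sewingConst₃, ?_⟩
  intro Ω mΩ P _ d T hT 𝓕 A m Γ₁ Γ₂ M α β₁ β₂ hm hΓ₁ hΓ₂ hM hα _ _ _ hAm hAp hAcond hAbound
    hβ₁ hβ₂ hβα
  -- The diagonal of `A` vanishes only almost surely, while the cancellations in grid sums are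
  -- identities of functions. The assumed estimates on `δA`, the bounds on `𝒜` and the Riemann sums
  -- involve `A s t` for `s < t` only, so the diagonal can be reset to zero.
  have hgerm : IsSewingGerm P 𝓕 (offDiagonal A) m Γ₁ Γ₂ M α β₁ β₂ :=
    { diag := offDiagonal_self A
      adapted := fun s t hst => by
        rcases hst.eq_or_lt with rfl | h
        · rw [offDiagonal_self]; exact stronglyMeasurable_zero
        · rw [offDiagonal_of_lt A h]; exact hAm s t hst
      memLp := fun s t hst => by
        rcases hst.eq_or_lt with rfl | h
        · rw [offDiagonal_self]; exact MemLp.zero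
        · rw [offDiagonal_of_lt A h]; exact hAp s t hst
      condBound := fun t₀ t₁ t₂ t₃ h01 h12 h23 h => by
        rw [sewDelta_offDiagonal A h12 h23]; exact hAcond t₀ t₁ t₂ t₃ h01 h12 h23 h
      bound := fun t₀ t₁ t₂ h01 h12 => by
        rw [sewDelta_offDiagonal A h01 h12]; exact hAbound t₀ t₁ t₂ h01 h12 }
  obtain ⟨𝒜, h0, h𝒜m, h𝒜p, hbounds⟩ :=
    hgerm.exists_sewing hm hΓ₁ hΓ₂ hM hα hβ₁ hβ₂ hβα hT
  have hκ := bdgConst_nonneg.{u} m d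
  have hC₁ : 0 ≤ sewingConst₁ β₁ * Γ₁ := mul_nonneg (sewingConst₁_nonneg hβ₁) hΓ₁
  have hC₂ : 0 ≤ sewingConst₂ α β₁ β₂ M * (bdgConst.{u} m d * Γ₁) :=
    mul_nonneg (sewingConst₂_nonneg hβ₁ hβα β₂ M) (mul_nonneg hκ hΓ₁)
  have hC₃ : 0 ≤ sewingConst₃ α β₁ β₂ M * (bdgConst.{u} m d * Γ₂) :=
    mul_nonneg (sewingConst₃_nonneg hβ₂ α β₁ M) (mul_nonneg hκ hΓ₂)
  have hsew : IsSewing P 𝓕 A m M α β₁ β₂ 𝒜 :=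
    ⟨h0, h𝒜m, h𝒜p, _, _, _, hC₁, hC₂, hC₃, hbounds.of_offDiagonal⟩
  exact ⟨𝒜, hsew, fun 𝒜' h' => hsew.ae_eq h' hm hAm hM hα hβ₁ hβ₂ hβα,
    ⟨_, _, _, hC₁, hC₂, hC₃, le_rfl, le_rfl, le_rfl, hbounds.of_offDiagonal⟩,
    hsew.tendsto_riemannSum hm hAm hM hα hβ₁ hβ₂ hβα⟩
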